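/- Let $c\in[0,\sqrt2)$ and let $\mathcal W\in L^1(\mathbb R)$ be real-valued and even, with $\int_{\mathbb R}\mathcal W=1$, $\mathcal W\ge 0$ and $\inf_{(-\tau,\tau)}\mathcal W>0$ for some $\tau>0$ (all pointwise conditions on $\mathcal W$ being understood almost everywhere). For $s\ge 0$ let $$\check{\mathcal W}(s)=\lim_{R\to\infty}\int_{-R}^{\infty}\mathcal W(y)e^{-sy}\,dy\in[0,\infty]$$ be its (generalized) two-sided Laplace transform, and assume that $$s^2-2\check{\mathcal W}(s)+c^2<-2cs\qquad\text{for all } s\ge 0,$$ the inequality being regarded as true when $\check{\mathcal W}(s)=\infty$. Let $u:\mathbb R\to\mathbb C$ be a nonconstant function in the energy space $$\mathcal E(\mathbb R)=\{v\in H^1_{\mathrm{loc}}(\mathbb R): 1-|v|^2\in L^2(\mathbb R),\ v'\in L^2(\mathbb R)\}$$ (functions in $H^1_{\mathrm{loc}}(\mathbb R)$ being identified with their continuous representatives) that solves $$icu'+u''+u\,\big(\mathcal W*(1-|u|^2)\big)=0\quad\text{in }\mathbb R$$ in the sense of distributions, and put $\eta=1-|u|^2$. Then $\eta$ is differentiable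 on $\mathbb R$ and, for every $x_0\in\mathbb R$, neither of the following two conditions holds: (a) $\eta\ge 0$ in $\mathbb R$ and $\eta'\ge 0$ in $(-\infty,x_0)$; (b) $\eta\le 0$ in $\mathbb R$ and $\eta'\le 0$ in $(-\infty,x_0)$. In particular, $\eta$ has an oscillation: there exist $x_1<x_2<x_3$ such that either $\eta'(x_1)>0$, $\eta'(x_2)<0$, $\eta'(x_3)>0$, or $\eta'(x_1)<0$, $\eta'(x_2)>0$, $\eta'(x_3)<0$. -/

import Mathlib

open MeasureTheory Set Filter Topology
open scoped ContDiff Convolution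

namespace NonlocalGP

/-- Real-valued smooth compactly supported test functions on the line. -/
def IsTestFunction (φ : ℝ → ℝ) : Prop :=
  ContDiff ℝ ∞ φ ∧ HasCompactSupport φ

/-- `v` is the weak (distributional) derivative of `u` on `ℝ`. -/
def HasWeakDeriv (u v : ℝ → ℂ) : Prop :=
  LocallyIntegrable u volume ∧ LocallyIntegrable v volume ∧
    ∀ φ : ℝ → ℝ, IsTestFunction φ →
      ∫ x, deriv φ x • u x = -∫ x, φ x • v x

/-- The deviation of the density from the background, `η = 1 - |u|²`. -/
noncomputable def density (u : ℝ → ℂ) (x : ℝ) : ℝ := 1 - ‖u x‖ ^ 2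

/-- The energy space: functions `u` in `H¹_loc(ℝ)` with `1 - |u|² ∈ L²(ℝ)` and weak derivative
`u' ∈ L²(ℝ)`. As usual in dimension one, an element of `H¹_loc(ℝ)` is identified with its
continuous representative (which is in `L²_loc`). -/
def energySpace : Set (ℝ → ℂ) :=
  {u | Continuous u ∧ MemLp (density u) 2 volume ∧
    ∃ v : ℝ → ℂ, HasWeakDeriv u v ∧ MemLp v 2 volume}

/-- The convolution `(W * f)(x) = ∫ W(y) f(x - y) dy` of real functions on the line. -/
noncomputable def conv (W f : ℝ → ℝ) : ℝ → ℝ :=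
  W ⋆[ContinuousLinearMap.mul ℝ ℝ, volume] f

/-- `u` solves `i c u' + u'' + u (W * (1 - |u|²)) = 0` on `ℝ` in the sense of distributions. -/
def IsSolution (W : ℝ → ℝ) (c : ℝ) (u : ℝ → ℂ) : Prop :=
  ∀ φ : ℝ → ℝ, IsTestFunction φ →
    ∫ x, (-(Complex.I * c * u x * deriv φ x) + u x * deriv (deriv φ) x
      + u x * conv W (density u) x * φ x) = 0

/-- The truncated two-sided Laplace transform `∫_{-R}^∞ W(y) e^{-s y} dy`. -/
noncomputable def laplaceTrunc (W : ℝ → ℝ) (s R : ℝ) : ℝ :=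
  ∫ y in Ioi (-R), W y * Real.exp (-(s * y))

/-- The generalized two-sided Laplace transform: the limit, as `R → ∞`, of the truncated
transforms, in the extended reals. The limit exists for nonnegative integrable `W` and `s ≥ 0`,
see `tendsto_laplaceTrunc`. -/
noncomputable def laplace (W : ℝ → ℝ) (s : ℝ) : EReal :=
  limUnder atTop (fun R : ℝ => (laplaceTrunc W s R : EReal))

theorem tendsto_laplaceTrunc {W : ℝ → ℝ} (hW : Integrable W) (hpos : ∀ᵐ x, 0 ≤ W x)
    {s : ℝ} (hs : 0 ≤ s) :
    Tendsto (fun R : ℝ => (laplaceTrunc W s R : EReal)) atTop (𝓝 (laplace W s)) := by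
  have hint : ∀ R : ℝ, IntegrableOn (fun y => W y * Real.exp (-(s * y))) (Ioi (-R)) := by
    intro R
    refine Integrable.mul_bdd (c := Real.exp (s * R)) hW.integrableOn ?_ ?_
    · exact (by fun_prop : Continuous fun y : ℝ => Real.exp (-(s * y))).aestronglyMeasurable
    · refine (ae_restrict_iff' measurableSet_Ioi).2 (Eventually.of_forall fun y hy => ?_)
      rw [Real.norm_eq_abs, Real.abs_exp, Real.exp_le_exp]
      have hy' : -R < y := hy
      nlinarith
  have hmono : Monotone (fun R : ℝ => (laplaceTrunc W s R : EReal)) := by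
    intro R R' h
    refine EReal.coe_le_coe_iff.2 ?_
    refine setIntegral_mono_set (hint R') ?_ ?_
    · filter_upwards [ae_restrict_of_ae hpos] with x hx
      exact mul_nonneg hx (Real.exp_pos _).le
    · exact (Ioi_subset_Ioi (neg_le_neg h)).eventuallyLE
  exact tendsto_nhds_limUnder ⟨_, tendsto_atTop_iSup hmono⟩

end NonlocalGP

/-! A finite energy solution is classical, and its density satisfies a scalar equation, η'' = 2(1 -
η) W*η - c²η - 2|u'|², together with 4(1 - η)|u'|² = η'² + c²η² (`exists_hydrodynamic`). At -∞ both
η and η' tend to 0, so if η has a sign and |η| is nondecreasing there, v = |η| satisfies, for every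
small ε and near -∞, (2 - ε) W*v ≤ v'' + εv' + (c² + ε)v.

Heuristically, a profile v ~ e^{sx} at -∞ would need s² + c² ≥ 2 times the Laplace transform of W at
s, which the hypothesis excludes for every s ≥ 0. To make this rigorous without knowing the
asymptotics of v, let S be the supremum of its exponential decay rates. A Harnack inequality
(`exists_harnack`) shows that S is finite. Take s slightly above S, multiply the inequality by
e^{-sx} and integrate over (l, b). The Laplace condition at S, which survives truncating W to [-R,
R] and a small change of s, gives P(l - R) ≥ (1 + 2κ)P(l) - C for P(l) = ∫_l^b v e^{-sx}. Since s is
not a decay rate, P is unbounded and therefore grows at least by the factor 1 + κ per step R. Decay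
at the rate S - δ < S bounds P(l) by a multiple of e^{-3δl}, which is slower growth when δ is small.
This is the contradiction in `false_of_monotone_supersolution`.

That v does not vanish near -∞ is a unique continuation argument: where η = 0 on a half line, W*η =
0 there too, and positivity of W near 0 pushes the zero set further. The oscillation then follows
from the mean value theorem and η → 0 at ±∞. -/

namespace NonlocalGP

/-! ### Test functions, weak derivatives and the lemmas of du Bois-Reymond. -/

namespace IsTestFunction

variable {φ : ℝ → ℝ}

theorem deriv (hφ : IsTestFunction φ) : IsTestFunction (deriv φ) :=
  ⟨(contDiff_infty_iff_deriv.1 hφ.1).2, hφ.2.deriv⟩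

theorem continuous (hφ : IsTestFunction φ) : Continuous φ := hφ.1.continuous

theorem hasDerivAt (hφ : IsTestFunction φ) (x : ℝ) : HasDerivAt φ (_root_.deriv φ x) x :=
  ((contDiff_infty_iff_deriv.1 hφ.1).1 x).hasDerivAt

theorem integrable (hφ : IsTestFunction φ) : Integrable φ :=
  hφ.continuous.integrable_of_hasCompactSupport hφ.2

theorem integrable_mul (hφ : IsTestFunction φ) {f : ℝ → ℝ} (hf : LocallyIntegrable f) :
    Integrable (fun x => φ x * f x) := by
  simpa using hf.integrable_smul_left_of_hasCompactSupport hφ.continuous hφ.2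

theorem exists_support_subset (hφ : IsTestFunction φ) :
    ∃ L > (0 : ℝ), tsupport φ ⊆ Ioo (-L) L := by
  obtain ⟨R, hR⟩ := hφ.2.isCompact.isBounded.subset_closedBall 0
  refine ⟨|R| + 1, by positivity, fun x hx => ?_⟩
  have h := hR hx
  rw [mem_closedBall_zero_iff, Real.norm_eq_abs] at h
  exact abs_lt.1 (by linarith [le_abs_self R])

end IsTestFunction

theorem integral_test_deriv_mul_primitive {φ G g : ℝ → ℝ} (hφ : IsTestFunction φ)
    (hg : Continuous g) (hG : ∀ x, HasDerivAt G (g x) x) :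
    ∫ x, deriv φ x * G x = -∫ x, φ x * g x := by
  have hGc : Continuous G := continuous_iff_continuousAt.2 fun x => (hG x).continuousAt
  have h := integral_mul_deriv_eq_deriv_mul_of_integrable (u := G) (v := φ) (u' := g)
    (v' := deriv φ) (fun x _ => hG x) (fun x _ => hφ.hasDerivAt x)
    ((hφ.deriv.integrable_mul hGc.locallyIntegrable).congr
      (Eventually.of_forall fun x => mul_comm _ _))
    ((hφ.integrable_mul hg.locallyIntegrable).congr
      (Eventually.of_forall fun x => mul_comm _ _))
    ((hφ.integrable_mul hGc.locallyIntegrable).congr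
      (Eventually.of_forall fun x => mul_comm _ _))
  simpa only [mul_comm] using h

/-- The primitive of a merely locally integrable function is absolutely continuous on a compact
interval around the support of `φ`. Integration by parts holds in that class, and Lebesgue
differentiation identifies the derivative almost everywhere. -/
theorem integral_test_deriv_mul_intervalIntegral {φ w : ℝ → ℝ} (hφ : IsTestFunction φ)
    (hw : LocallyIntegrable w) :
    ∫ x, deriv φ x * (∫ t in (0 : ℝ)..x, w t) = -∫ x, φ x * w x := by
  obtain ⟨L, hL, hsupp⟩ := hφ.exists_support_subset
  have hLL : (-L) ≤ L := by linarith
  have hwi : ∀ a b : ℝ, IntervalIntegrable w volume a b := fun a b =>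
    (hw.integrableOn_isCompact isCompact_uIcc).intervalIntegrable
  have hV : AbsolutelyContinuousOnInterval (fun x => ∫ t in (0 : ℝ)..x, w t) (-L) L :=
    (hwi (-L) L).absolutelyContinuousOnInterval_intervalIntegral (c := 0)
      (by rw [uIcc_of_le hLL]; exact ⟨by linarith, by linarith⟩)
  have hφac : AbsolutelyContinuousOnInterval φ (-L) L :=
    ContDiffOn.absolutelyContinuousOnInterval ((hφ.1.of_le (by exact_mod_cast le_top)).contDiffOn)
  have hzero : ∀ x, x ∉ Ioo (-L) L → φ x = 0 := fun x hx =>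
    image_eq_zero_of_notMem_tsupport fun h => hx (hsupp h)
  have hsub : ∀ f : ℝ → ℝ, (Function.support fun x => φ x * f x) ⊆ Ioc (-L) L := by
    intro f x hx
    by_contra h
    exact hx (by simp [hzero x fun h' => h (Ioo_subset_Ioc_self h')])
  have hsub' : ∀ f : ℝ → ℝ, (Function.support fun x => deriv φ x * f x) ⊆ Ioc (-L) L := by
    intro f x hx
    by_contra h
    refine hx ?_
    have : deriv φ x = 0 := image_eq_zero_of_notMem_tsupport fun h' =>
      h (Ioo_subset_Ioc_self (hsupp (tsupport_deriv_subset (𝕜 := ℝ) h')))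
    simp [this]
  have hibp := AbsolutelyContinuousOnInterval.integral_mul_deriv_eq_deriv_mul hφac hV
  rw [hzero L (by simp), hzero (-L) (by simp)] at hibp
  rw [← intervalIntegral.integral_eq_integral_of_support_subset (hsub' _),
    ← intervalIntegral.integral_eq_integral_of_support_subset (hsub _)]
  have hcongr : ∫ x in (-L)..L, φ x * deriv (fun x => ∫ t in (0 : ℝ)..x, w t) x
      = ∫ x in (-L)..L, φ x * w x := by
    apply intervalIntegral.integral_congr_ae
    filter_upwards [LocallyIntegrable.ae_hasDerivAt_integral hw] with x hx _
    rw [(hx 0).deriv]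
  rw [hcongr] at hibp
  linarith

/-- A test function of mean zero is the derivative of a test function. -/
theorem exists_isTestFunction_deriv_eq {φ : ℝ → ℝ} (hφ : IsTestFunction φ)
    (h0 : ∫ x, φ x = 0) : ∃ Φ, IsTestFunction Φ ∧ deriv Φ = φ := by
  obtain ⟨L, hL, hsupp⟩ := hφ.exists_support_subset
  have hzero : ∀ x, x ∉ Ioo (-L) L → φ x = 0 := fun x hx =>
    image_eq_zero_of_notMem_tsupport fun h => hx (hsupp h)
  have hd : ∀ x, HasDerivAt (fun x => ∫ t in (-L)..x, φ t) (φ x) x := fun x =>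
    intervalIntegral.integral_hasDerivAt_right (hφ.continuous.intervalIntegrable _ _)
      hφ.continuous.stronglyMeasurable.stronglyMeasurableAtFilter hφ.continuous.continuousAt
  have hde : deriv (fun x => ∫ t in (-L)..x, φ t) = φ := funext fun x => (hd x).deriv
  refine ⟨fun x => ∫ t in (-L)..x, φ t, ⟨?_, ?_⟩, hde⟩
  · rw [contDiff_infty_iff_deriv, hde]
    exact ⟨fun x => (hd x).differentiableAt, hφ.1⟩
  · refine HasCompactSupport.intro (isCompact_Icc (a := -L) (b := L)) fun x hx => ?_
    rcases lt_or_ge x (-L) with h | h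
    · show ∫ t in (-L)..x, φ t = 0
      rw [intervalIntegral.integral_congr (g := fun _ => (0 : ℝ)), intervalIntegral.integral_zero]
      intro t ht
      rw [uIcc_of_ge h.le] at ht
      exact hzero t fun h' => by linarith [ht.2, h'.1]
    -- To the right of the support the primitive is the full integral of `φ`, which is zero by `h0`.
    · have hxL : L < x := by
        by_contra h'
        exact hx ⟨h, not_lt.1 h'⟩
      show ∫ t in (-L)..x, φ t = 0
      rw [intervalIntegral.integral_eq_integral_of_support_subset, h0]
      intro t ht
      by_contra h'
      exact ht (hzero t fun h'' => h' ⟨h''.1, by linarith [h''.2]⟩)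

theorem exists_isTestFunction_integral_eq_one : ∃ ψ, IsTestFunction ψ ∧ ∫ x, ψ x = 1 := by
  let b : ContDiffBump (0 : ℝ) := ⟨1, 2, one_pos, one_lt_two⟩
  exact ⟨b.normed volume, ⟨b.contDiff_normed, b.hasCompactSupport_normed⟩, b.integral_normed⟩

theorem eq_zero_of_integral_test_mul {f : ℝ → ℝ} (hf : Continuous f)
    (h : ∀ φ, IsTestFunction φ → ∫ x, φ x * f x = 0) : f = 0 := by
  have := ae_eq_zero_of_integral_contDiff_smul_eq_zero (μ := volume) hf.locallyIntegrable
    (fun g hg hg' => by simpa using h g ⟨hg, hg'⟩)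
  exact (Continuous.ae_eq_iff_eq volume hf continuous_zero).1 this

theorem IsTestFunction.sub_smul {φ ψ : ℝ → ℝ} (hφ : IsTestFunction φ) (hψ : IsTestFunction ψ)
    (a : ℝ) : IsTestFunction (fun x => φ x - a * ψ x) :=
  ⟨hφ.1.sub (contDiff_const.mul hψ.1), hφ.2.sub hψ.2.mul_left⟩

/-- The lemma of du Bois-Reymond. -/
theorem eq_const_of_integral_deriv_test_mul {f : ℝ → ℝ} (hf : Continuous f)
    (h : ∀ φ, IsTestFunction φ → ∫ x, deriv φ x * f x = 0) : ∃ C, ∀ x, f x = C := by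
  obtain ⟨ψ, hψ, hψ1⟩ := exists_isTestFunction_integral_eq_one
  -- The constant must be the ψ-average of f. Correcting any test function by a multiple of ψ gives
  -- it mean zero, hence makes it a derivative.
  refine ⟨∫ x, ψ x * f x, fun x => ?_⟩
  have key : (fun x => f x - ∫ x, ψ x * f x) = 0 := by
    refine eq_zero_of_integral_test_mul (by fun_prop) fun φ hφ => ?_
    have hm : ∫ x, (φ x - (∫ y, φ y) * ψ x) = 0 := by
      rw [integral_sub hφ.integrable (hψ.integrable.const_mul _), integral_const_mul, hψ1]
      ring
    obtain ⟨Φ, hΦ, hΦ'⟩ := exists_isTestFunction_deriv_eq (hφ.sub_smul hψ _) hm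
    have h1 := h Φ hΦ
    rw [hΦ'] at h1
    have e : ∀ x, (φ x - (∫ y, φ y) * ψ x) * f x = φ x * f x - (∫ y, φ y) * (ψ x * f x) :=
      fun x => by ring
    simp only [e] at h1
    rw [integral_sub (hφ.integrable_mul hf.locallyIntegrable)
      ((hψ.integrable_mul hf.locallyIntegrable).const_mul _), integral_const_mul] at h1
    simp only [mul_sub]
    rw [integral_sub (hφ.integrable_mul hf.locallyIntegrable) (hφ.integrable.mul_const _),
      integral_mul_const]
    linarith
  have := congrFun key x
  simp only [Pi.zero_apply] at this
  linarith

/-- The second order lemma of du Bois-Reymond. -/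
theorem eq_affine_of_integral_deriv_deriv_test_mul {f : ℝ → ℝ} (hf : Continuous f)
    (h : ∀ φ, IsTestFunction φ → ∫ x, deriv (deriv φ) x * f x = 0) :
    ∃ A B, ∀ x, f x = A + B * x := by
  obtain ⟨ψ, hψ, hψ1⟩ := exists_isTestFunction_integral_eq_one
  -- Testing an affine function against ψ' yields minus its slope, so `C` is the only possible value
  -- of -B.
  set C := ∫ x, deriv ψ x * f x with hC
  suffices H : ∃ A, ∀ x, f x + C * x = A by
    obtain ⟨A, hA⟩ := H
    exact ⟨A, -C, fun x => by linarith [hA x]⟩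
  refine eq_const_of_integral_deriv_test_mul (by fun_prop) fun φ hφ => ?_
  have hm : ∫ x, (φ x - (∫ y, φ y) * ψ x) = 0 := by
    rw [integral_sub hφ.integrable (hψ.integrable.const_mul _), integral_const_mul, hψ1]
    ring
  obtain ⟨Φ, hΦ, hΦ'⟩ := exists_isTestFunction_deriv_eq (hφ.sub_smul hψ _) hm
  have h1 := h Φ hΦ
  rw [hΦ'] at h1
  have e : ∀ x, deriv (fun x => φ x - (∫ y, φ y) * ψ x) x * f x
      = deriv φ x * f x - (∫ y, φ y) * (deriv ψ x * f x) := fun x => by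
    rw [((hφ.hasDerivAt x).fun_sub ((hψ.hasDerivAt x).const_mul _)).deriv]
    ring
  simp only [e] at h1
  rw [integral_sub (hφ.deriv.integrable_mul hf.locallyIntegrable)
    ((hψ.deriv.integrable_mul hf.locallyIntegrable).const_mul _), integral_const_mul, ← hC] at h1
  have h2 := integral_test_deriv_mul_primitive hφ (continuous_const (y := C))
    (fun x => by simpa using (hasDerivAt_id x).const_mul C : ∀ x, HasDerivAt (fun x => C * x) C x)
  rw [integral_mul_const] at h2
  simp only [mul_add]
  rw [integral_add (hφ.deriv.integrable_mul hf.locallyIntegrable)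
    (hφ.deriv.integrable_mul (by fun_prop : Continuous fun x : ℝ => C * x).locallyIntegrable)]
  linarith

/-- p minus the primitive of its weak derivative has zero weak derivative, hence is constant. -/
theorem sub_eq_intervalIntegral_of_weakDeriv {p w : ℝ → ℝ} (hp : Continuous p)
    (hw : LocallyIntegrable w)
    (h : ∀ φ, IsTestFunction φ → ∫ x, deriv φ x * p x = -∫ x, φ x * w x) (x y : ℝ) :
    p y - p x = ∫ t in x..y, w t := by
  have hwi : ∀ a b : ℝ, IntervalIntegrable w volume a b := fun a b =>
    (hw.integrableOn_isCompact isCompact_uIcc).intervalIntegrable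
  have hVc : Continuous fun x => ∫ t in (0 : ℝ)..x, w t :=
    intervalIntegral.continuous_primitive hwi 0
  obtain ⟨C, hC⟩ := eq_const_of_integral_deriv_test_mul
      (f := fun x => p x - ∫ t in (0 : ℝ)..x, w t) (hp.sub hVc) fun φ hφ => by
    simp only [mul_sub]
    rw [integral_sub (hφ.deriv.integrable_mul hp.locallyIntegrable)
      (hφ.deriv.integrable_mul hVc.locallyIntegrable), h φ hφ,
      integral_test_deriv_mul_intervalIntegral hφ hw, sub_self]
  rw [← intervalIntegral.integral_interval_sub_left (hwi 0 y) (hwi 0 x)]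
  linarith [hC x, hC y]

/-- Distributional solutions of `f'' - g' + F = 0` with continuous data are classical. -/
theorem exists_hasDerivAt_of_weak_equation {f g F : ℝ → ℝ} (hf : Continuous f)
    (hg : Continuous g) (hF : Continuous F)
    (h : ∀ φ, IsTestFunction φ →
      ∫ x, (deriv φ x * g x + deriv (deriv φ) x * f x + φ x * F x) = 0) :
    ∃ f₁ : ℝ → ℝ, (∀ x, HasDerivAt f (f₁ x) x) ∧
      ∀ x, HasDerivAt (fun x => f₁ x - g x) (-F x) x := by
  have prim : ∀ {k : ℝ → ℝ}, Continuous k → ∀ x,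
      HasDerivAt (fun x => ∫ t in (0 : ℝ)..x, k t) (k x) x := fun hk x =>
    intervalIntegral.integral_hasDerivAt_right (hk.intervalIntegrable _ _)
      hk.stronglyMeasurable.stronglyMeasurableAtFilter hk.continuousAt
  have primc : ∀ {k : ℝ → ℝ}, Continuous k → Continuous (fun x => ∫ t in (0 : ℝ)..x, k t) :=
    fun hk => continuous_iff_continuousAt.2 fun x => (prim hk x).continuousAt
  set G := fun x => ∫ t in (0 : ℝ)..x, g t with hG
  set H₁ := fun x => ∫ t in (0 : ℝ)..x, F t with hH₁
  set H := fun x => ∫ t in (0 : ℝ)..x, H₁ t with hH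
  have hGc : Continuous G := primc hg
  have hH₁c : Continuous H₁ := primc hF
  have hHc : Continuous H := primc hH₁c
  -- As G'' = g' and H'' = F weakly, the equation says that f - G + H has zero second weak
  -- derivative.
  obtain ⟨A, B, hAB⟩ := eq_affine_of_integral_deriv_deriv_test_mul
    (f := fun x => f x - G x + H x) (by fun_prop) fun φ hφ => by
      have h1 := h φ hφ
      have i1 := hφ.deriv.integrable_mul hg.locallyIntegrable
      have i2 := hφ.deriv.deriv.integrable_mul hf.locallyIntegrable
      have i3 := hφ.integrable_mul hF.locallyIntegrable
      have i4 := hφ.deriv.deriv.integrable_mul hGc.locallyIntegrable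
      have i5 := hφ.deriv.deriv.integrable_mul hHc.locallyIntegrable
      have i12 : Integrable fun x => deriv φ x * g x + deriv (deriv φ) x * f x := i1.add i2
      have i24 : Integrable fun x => deriv (deriv φ) x * f x - deriv (deriv φ) x * G x := i2.sub i4
      rw [integral_add i12 i3, integral_add i1 i2] at h1
      have e1 := integral_test_deriv_mul_primitive hφ.deriv hg (prim hg)
      have e2 := integral_test_deriv_mul_primitive hφ.deriv hH₁c (prim hH₁c)
      have e3 := integral_test_deriv_mul_primitive hφ hF (prim hF)
      simp only [mul_add, mul_sub]
      rw [integral_add i24 i5, integral_sub i2 i4]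
      linarith
  refine ⟨fun x => B + g x - H₁ x, fun x => ?_, fun x => ?_⟩
  · have e : f = fun x => A + B * x + G x - H x := funext fun x => by linarith [hAB x]
    rw [e]
    have := ((((hasDerivAt_id x).const_mul B).const_add A).add (prim hg x)).sub (prim hH₁c x)
    simpa using! this
  · have e : (fun x => B + g x - H₁ x - g x) = fun x => B - H₁ x := funext fun x => by ring
    rw [e]
    exact (prim hF x).const_sub B

/-! ### Regularity of finite energy solutions and their behaviour at infinity. -/

/-- From |w| ≤ k w² + 1/(4k) one gets |p b - p a| ≤ k‖w‖² + |b - a|/(4k). The weight k makes the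
first term at most ε/2, and |b - a| < 2kε then makes the second one smaller than ε/2. -/
theorem uniformContinuous_of_sub_eq_intervalIntegral {p w : ℝ → ℝ} (hw : MemLp w 2 volume)
    (h : ∀ x y, p y - p x = ∫ t in x..y, w t) : UniformContinuous p := by
  have hw2 : Integrable fun x => w x ^ 2 := hw.integrable_sq
  set A := ∫ x, w x ^ 2 with hA
  have hA0 : 0 ≤ A := integral_nonneg fun x => sq_nonneg _
  refine Metric.uniformContinuous_iff.2 fun ε hε => ?_
  set k := ε / (2 * (A + 1)) with hk
  have hk0 : 0 < k := by positivity
  have hkA : k * A ≤ ε / 2 := by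
    rw [hk, div_mul_eq_mul_div, div_le_iff₀ (by positivity)]
    nlinarith
  refine ⟨2 * k * ε, by positivity, fun {a b} hab => ?_⟩
  rw [dist_comm, Real.dist_eq, h a b]
  have hfin : volume (uIoc a b) ≠ ⊤ := by
    rw [uIoc_eq_union]; exact (measure_union_lt_top measure_Ioc_lt_top measure_Ioc_lt_top).ne
  have i1 : IntegrableOn (fun x => k * w x ^ 2) (uIoc a b) := (hw2.const_mul k).integrableOn
  have i2 : IntegrableOn (fun _ : ℝ => 1 / (4 * k)) (uIoc a b) := integrableOn_const hfin
  have i12 : IntegrableOn (fun x => k * w x ^ 2 + 1 / (4 * k)) (uIoc a b) := i1.add i2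
  have hle : ∀ x, ‖w x‖ ≤ k * w x ^ 2 + 1 / (4 * k) := fun x => by
    rw [Real.norm_eq_abs, ← sq_abs (w x)]
    have e : k * |w x| ^ 2 + 1 / (4 * k) - |w x| = k * (|w x| - 1 / (2 * k)) ^ 2 := by
      field_simp; ring
    have : 0 ≤ k * (|w x| - 1 / (2 * k)) ^ 2 := by positivity
    linarith
  have hwl : IntegrableOn (fun x => ‖w x‖) (uIoc a b) := by
    refine Integrable.mono' i12 hw.1.restrict.norm (Eventually.of_forall fun x => ?_)
    simpa using hle x
  have hvol : (volume.real (uIoc a b)) = |b - a| := by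
    rw [measureReal_def, Real.volume_uIoc, ENNReal.toReal_ofReal (abs_nonneg _)]
  calc |∫ t in a..b, w t| ≤ ∫ t in uIoc a b, ‖w t‖ := by
        rw [← Real.norm_eq_abs]; exact intervalIntegral.norm_integral_le_integral_norm_uIoc
    _ ≤ ∫ t in uIoc a b, (k * w t ^ 2 + 1 / (4 * k)) := integral_mono hwl i12 hle
    _ = (∫ t in uIoc a b, k * w t ^ 2) + |b - a| * (1 / (4 * k)) := by
        rw [integral_add i1 i2, setIntegral_const, smul_eq_mul, hvol]
    _ ≤ k * A + |b - a| * (1 / (4 * k)) := by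
        gcongr
        rw [← integral_const_mul]
        exact setIntegral_le_integral (hw2.const_mul k)
          (Eventually.of_forall fun x => by positivity)
    _ < ε := by
        rw [dist_comm, Real.dist_eq] at hab
        have : |b - a| * (1 / (4 * k)) < ε / 2 := by
          rw [mul_one_div, div_lt_iff₀ (by positivity)]
          linarith
        linarith

/-- Barbalat's argument: where |f x| ≥ ε, uniform continuity keeps |f| ≥ ε/2 on an interval of fixed
length, so the integral of f² gains a fixed amount, against its convergence. Translation invariance
of `l` is what both `atBot` and `atTop` share. -/
theorem tendsto_zero_of_tendsto_intervalIntegral_sq {f : ℝ → ℝ} (hu : UniformContinuous f)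
    {l : Filter ℝ} (hl : ∀ δ : ℝ, Tendsto (fun x => x + δ) l l)
    {I : ℝ} (hI : Tendsto (fun x => ∫ t in (0 : ℝ)..x, f t ^ 2) l (𝓝 I)) :
    Tendsto f l (𝓝 0) := by
  refine Metric.tendsto_nhds.2 fun ε hε => ?_
  obtain ⟨δ, hδ, H⟩ := Metric.uniformContinuous_iff.1 hu (ε / 2) (by positivity)
  have hi : ∀ a b, IntervalIntegrable (fun t => f t ^ 2) volume a b := fun a b =>
    (hu.continuous.pow 2).intervalIntegrable a b
  have hT := (hI.comp (hl (δ / 2))).sub hI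
  rw [sub_self] at hT
  filter_upwards [hT.eventually (gt_mem_nhds (show (0 : ℝ) < δ / 2 * (ε / 2) ^ 2 by positivity))]
    with x hx
  rw [dist_zero_right, Real.norm_eq_abs]
  by_contra hge
  rw [not_lt] at hge
  simp only [Function.comp] at hx
  rw [intervalIntegral.integral_interval_sub_left (hi _ _) (hi _ _)] at hx
  have : ∫ t in x..(x + δ / 2), (ε / 2) ^ 2 ≤ ∫ t in x..(x + δ / 2), f t ^ 2 := by
    refine intervalIntegral.integral_mono_on (by linarith) (by simp) (hi _ _) fun t ht => ?_
    have hd : dist x t < δ := by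
      rw [dist_comm, Real.dist_eq, abs_lt]; constructor <;> linarith [ht.1, ht.2]
    have h1 := H hd
    rw [Real.dist_eq] at h1
    rw [← sq_abs (f t)]
    have h2 : |f x| ≤ |f x - f t| + |f t| := by
      simpa using abs_add_le (f x - f t) (f t)
    gcongr
    linarith
  rw [intervalIntegral.integral_const] at this
  simp only [add_sub_cancel_left, smul_eq_mul] at this
  linarith

theorem tendsto_zero_of_uniformContinuous_of_memLp {f : ℝ → ℝ} (hu : UniformContinuous f)
    (hf : MemLp f 2 volume) : Tendsto f atBot (𝓝 0) ∧ Tendsto f atTop (𝓝 0) := by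
  have hi := hf.integrable_sq
  refine ⟨tendsto_zero_of_tendsto_intervalIntegral_sq hu
      (fun δ => tendsto_atBot_add_const_right _ δ tendsto_id) (I := -∫ x in Iic 0, f x ^ 2) ?_,
    tendsto_zero_of_tendsto_intervalIntegral_sq hu
      (fun δ => tendsto_atTop_add_const_right _ δ tendsto_id)
      (intervalIntegral_tendsto_integral_Ioi 0 hi.integrableOn tendsto_id)⟩
  have := (intervalIntegral_tendsto_integral_Iic (0 : ℝ) hi.integrableOn tendsto_id).neg
  refine this.congr fun x => ?_
  rw [intervalIntegral.integral_symm x 0]; simp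

theorem exists_bound_of_tendsto {f : ℝ → ℝ} (hf : Continuous f) (hb : Tendsto f atBot (𝓝 0))
    (ht : Tendsto f atTop (𝓝 0)) : ∃ B, ∀ x, |f x| ≤ B := by
  obtain ⟨a, ha⟩ := eventually_atBot.1 (Metric.tendsto_nhds.1 hb 1 one_pos)
  obtain ⟨b, hb⟩ := eventually_atTop.1 (Metric.tendsto_nhds.1 ht 1 one_pos)
  obtain ⟨C, hC⟩ := (isCompact_Icc (a := a) (b := b)).exists_bound_of_continuousOn hf.continuousOn
  refine ⟨max 1 C, fun x => ?_⟩
  by_cases h1 : x ≤ a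
  · have := ha x h1
    rw [dist_zero_right, Real.norm_eq_abs] at this
    exact this.le.trans (le_max_left _ _)
  by_cases h2 : b ≤ x
  · have := hb x h2
    rw [dist_zero_right, Real.norm_eq_abs] at this
    exact this.le.trans (le_max_left _ _)
  exact (hC x ⟨by linarith, by linarith⟩).trans (le_max_right _ _)

theorem continuous_conv {W f : ℝ → ℝ} (hW : Integrable W) (hf : Continuous f) {B : ℝ}
    (hB : ∀ x, |f x| ≤ B) : Continuous (conv W f) := by
  unfold conv
  refine BddAbove.continuous_convolution_right_of_integrable (ContinuousLinearMap.mul ℝ ℝ)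
    ⟨B, ?_⟩ hW hf
  rintro _ ⟨x, rfl⟩
  exact hB x

theorem conv_apply (W f : ℝ → ℝ) (x : ℝ) : conv W f x = ∫ y, W y * f (x - y) := rfl

theorem integrable_conv_integrand {W f : ℝ → ℝ} (hW : Integrable W) (hf : Continuous f) {B : ℝ}
    (hB : ∀ x, |f x| ≤ B) (x : ℝ) : Integrable fun y => W y * f (x - y) :=
  hW.mul_bdd (c := B) (by fun_prop : Continuous fun y => f (x - y)).aestronglyMeasurable
    (Eventually.of_forall fun y => hB _)

theorem abs_conv_le {W f : ℝ → ℝ} (hW : Integrable W) {B : ℝ}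
    (hB : ∀ x, |f x| ≤ B) (x : ℝ) : |conv W f x| ≤ (∫ y, |W y|) * B := by
  rw [conv_apply, ← integral_mul_const]
  rw [← Real.norm_eq_abs]
  refine norm_integral_le_of_norm_le (hW.abs.mul_const B) (Eventually.of_forall fun y => ?_)
  rw [norm_mul]
  exact mul_le_mul_of_nonneg_left (hB _) (abs_nonneg _)

theorem uniformContinuous_of_bounded_hasDerivAt {f f' : ℝ → ℝ}
    (hf : ∀ x, HasDerivAt f (f' x) x) {C : ℝ} (hC : ∀ x, |f' x| ≤ C) : UniformContinuous f := by
  have hC0 : 0 ≤ C := (abs_nonneg _).trans (hC 0)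
  refine (lipschitzWith_of_nnnorm_deriv_le (C := ⟨C, hC0⟩)
    (fun x => (hf x).differentiableAt) fun x => ?_).uniformContinuous
  rw [(hf x).deriv]
  exact hC x

/-- Finite energy solutions are classical, and `1 - |u|²` and `u'` vanish at infinity. -/
theorem exists_classical_solution {c : ℝ} {W : ℝ → ℝ} (hW : Integrable W) {u : ℝ → ℂ}
    (hu : u ∈ energySpace) (hsol : IsSolution W c u) :
    ∃ p₁ q₁ : ℝ → ℝ,
      (∀ x, HasDerivAt (fun x => (u x).re) (p₁ x) x) ∧
      (∀ x, HasDerivAt (fun x => (u x).im) (q₁ x) x) ∧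
      (∀ x, HasDerivAt p₁ (c * q₁ x - (u x).re * conv W (density u) x) x) ∧
      (∀ x, HasDerivAt q₁ (-(c * p₁ x) - (u x).im * conv W (density u) x) x) ∧
      Tendsto p₁ atBot (𝓝 0) ∧ Tendsto q₁ atBot (𝓝 0) ∧
      Tendsto (density u) atBot (𝓝 0) ∧ Tendsto (density u) atTop (𝓝 0) ∧
      Continuous (density u) ∧ (∃ B, ∀ x, |density u x| ≤ B) ∧
      Continuous (conv W (density u)) := by
  obtain ⟨huc, hη, v, ⟨hul, hvl, hweak⟩, hv⟩ := hu
  set p := fun x => (u x).re with hp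
  set q := fun x => (u x).im with hq
  have hpc : Continuous p := Complex.continuous_re.comp huc
  have hqc : Continuous q := Complex.continuous_im.comp huc
  have hηc : Continuous (density u) := by unfold density; fun_prop
  have hvre : MemLp (fun x => (v x).re) 2 volume := hv.re
  have hvim : MemLp (fun x => (v x).im) 2 volume := hv.im
  have hwre : LocallyIntegrable fun x => (v x).re := hvre.locallyIntegrable one_le_two
  have hwim : LocallyIntegrable fun x => (v x).im := hvim.locallyIntegrable one_le_two
  have int_smul : ∀ {φ : ℝ → ℝ}, IsTestFunction φ → ∀ {f : ℝ → ℂ}, LocallyIntegrable f →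
      Integrable fun x => φ x • f x := fun hφ _ hf =>
    hf.integrable_smul_left_of_hasCompactSupport hφ.continuous hφ.2
  have hweak_re : ∀ φ, IsTestFunction φ → ∫ x, deriv φ x * p x = -∫ x, φ x * (v x).re := by
    intro φ hφ
    have h1 := congrArg Complex.re (hweak φ hφ)
    rw [Complex.neg_re, ← Complex.reCLM_apply, ← Complex.reCLM_apply,
      ← ContinuousLinearMap.integral_comp_comm _ (int_smul hφ.deriv hul),
      ← ContinuousLinearMap.integral_comp_comm _ (int_smul hφ hvl)] at h1
    simpa using h1
  have hweak_im : ∀ φ, IsTestFunction φ → ∫ x, deriv φ x * q x = -∫ x, φ x * (v x).im := by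
    intro φ hφ
    have h1 := congrArg Complex.im (hweak φ hφ)
    rw [Complex.neg_im, ← Complex.imCLM_apply, ← Complex.imCLM_apply,
      ← ContinuousLinearMap.integral_comp_comm _ (int_smul hφ.deriv hul),
      ← ContinuousLinearMap.integral_comp_comm _ (int_smul hφ hvl)] at h1
    simpa using h1
  have hp_int := sub_eq_intervalIntegral_of_weakDeriv hpc hwre hweak_re
  have hq_int := sub_eq_intervalIntegral_of_weakDeriv hqc hwim hweak_im
  have hpu := uniformContinuous_of_sub_eq_intervalIntegral hvre hp_int
  have hqu := uniformContinuous_of_sub_eq_intervalIntegral hvim hq_int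
  have huu : UniformContinuous u := by
    have : UniformContinuous fun x => (⟨p x, q x⟩ : ℂ) := by
      have e : (fun x => (⟨p x, q x⟩ : ℂ)) = fun x => Complex.equivRealProdCLM.symm (p x, q x) := by
        ext x
        rw [Complex.equivRealProdCLM_symm_apply, Complex.mk_eq_add_mul_I]
      rw [e]
      exact Complex.equivRealProdCLM.symm.toContinuousLinearMap.uniformContinuous.comp (hpu.prodMk hqu)
    exact this
  -- Since u is not yet known to be bounded, uniform continuity is not available for η = 1 - |u|²
  -- directly. It is for |u| - 1, which is dominated by η because |u| + 1 ≥ 1.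
  have hρu : UniformContinuous fun x => ‖u x‖ - 1 :=
    (uniformContinuous_norm.comp huu).sub uniformContinuous_const
  have hρL : MemLp (fun x => ‖u x‖ - 1) 2 volume := by
    refine hη.mono hρu.continuous.aestronglyMeasurable (Eventually.of_forall fun x => ?_)
    have e : density u x = -((‖u x‖ - 1) * (‖u x‖ + 1)) := by unfold density; ring
    rw [e, norm_neg, norm_mul, Real.norm_of_nonneg (show 0 ≤ ‖u x‖ + 1 by positivity)]
    nlinarith [norm_nonneg (‖u x‖ - 1), norm_nonneg (u x)]
  obtain ⟨hρb, hρt⟩ := tendsto_zero_of_uniformContinuous_of_memLp hρu hρL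
  have hηρ : ∀ x, -((‖u x‖ - 1) * ((‖u x‖ - 1) + 2)) = density u x := fun x => by
    unfold density; ring
  have hηb : Tendsto (density u) atBot (𝓝 0) := by
    have := (hρb.mul (hρb.add_const 2)).neg
    simp only [hηρ, zero_mul, neg_zero] at this
    exact this
  have hηt : Tendsto (density u) atTop (𝓝 0) := by
    have := (hρt.mul (hρt.add_const 2)).neg
    simp only [hηρ, zero_mul, neg_zero] at this
    exact this
  obtain ⟨B, hB⟩ := exists_bound_of_tendsto hηc hηb hηt
  set N := conv W (density u) with hN
  have hNc : Continuous N := continuous_conv hW hηc hB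
  have hNB := abs_conv_le hW hB
  rw [← hN] at hNB
  have hpq : ∀ x, p x ^ 2 + q x ^ 2 = 1 - density u x := fun x => by
    rw [density, ← Complex.normSq_eq_norm_sq, Complex.normSq_apply]; simp only [hp, hq]; ring
  have hsol_int : ∀ φ, IsTestFunction φ → Integrable fun x =>
      (-(Complex.I * c * u x * ((deriv φ x : ℝ) : ℂ)) + u x * ((deriv (deriv φ) x : ℝ) : ℂ)
        + u x * (N x : ℂ) * (φ x : ℂ)) := by
    intro φ hφ
    have hNl : LocallyIntegrable fun x => u x * (N x : ℂ) :=
      (by fun_prop : Continuous fun x => u x * (N x : ℂ)).locallyIntegrable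
    have h1 : LocallyIntegrable fun x => Complex.I * c * u x :=
      (by fun_prop : Continuous fun x => Complex.I * c * u x).locallyIntegrable
    refine (((int_smul hφ.deriv h1).neg.add (int_smul hφ.deriv.deriv hul)).add
      (int_smul hφ hNl)).congr (Eventually.of_forall fun x => ?_)
    simp only [Pi.add_apply, Pi.neg_apply, Complex.real_smul]
    ring
  -- With u = p + iq and N = W * η, the real part of the equation is p'' - (cq)' + pN = 0.
  obtain ⟨p₁, hp₁, hp₂⟩ := exists_hasDerivAt_of_weak_equation (f := p) (g := fun x => c * q x)
    (F := fun x => p x * N x) hpc (by fun_prop) (by fun_prop) fun φ hφ => by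
      have h1 := congrArg Complex.re (hsol φ hφ)
      rw [← Complex.reCLM_apply, ← ContinuousLinearMap.integral_comp_comm _ (hsol_int φ hφ)] at h1
      rw [← Complex.zero_re, ← h1]
      refine integral_congr_ae (Eventually.of_forall fun x => ?_)
      simp [hp, hq]
      ring
  obtain ⟨q₁, hq₁, hq₂⟩ := exists_hasDerivAt_of_weak_equation (f := q) (g := fun x => -(c * p x))
    (F := fun x => q x * N x) hqc (by fun_prop) (by fun_prop) fun φ hφ => by
      have h1 := congrArg Complex.im (hsol φ hφ)
      rw [← Complex.imCLM_apply, ← ContinuousLinearMap.integral_comp_comm _ (hsol_int φ hφ)] at h1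
      rw [← Complex.zero_im, ← h1]
      refine integral_congr_ae (Eventually.of_forall fun x => ?_)
      simp [hp, hq]
      ring
  have hB0 : 0 ≤ B := (abs_nonneg _).trans (hB 0)
  have abs_le_of_sq : ∀ {a : ℝ}, a ^ 2 ≤ 1 + B → |a| ≤ 1 + B := fun {a} h => by
    nlinarith [abs_nonneg a, sq_abs a]
  have hpB : ∀ x, |p x| ≤ 1 + B := fun x => abs_le_of_sq (by
    nlinarith [hpq x, sq_nonneg (q x), neg_abs_le (density u x), hB x])
  have hqB : ∀ x, |q x| ≤ 1 + B := fun x => abs_le_of_sq (by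
    nlinarith [hpq x, sq_nonneg (p x), neg_abs_le (density u x), hB x])
  -- p' - cq has the bounded derivative -pN, so p' is uniformly continuous. Being also in L², it
  -- vanishes at infinity.
  have hp₁u : UniformContinuous p₁ := by
    have h1 : UniformContinuous fun x => p₁ x - c * q x :=
      uniformContinuous_of_bounded_hasDerivAt hp₂ (C := (1 + B) * ((∫ y, |W y|) * B)) fun x => by
        rw [abs_neg, abs_mul]
        exact mul_le_mul (hpB x) (hNB x) (abs_nonneg _) (by positivity)
    have h2 := h1.add (hqu.const_smul c)
    simpa using! h2
  have hq₁u : UniformContinuous q₁ := by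
    have h1 : UniformContinuous fun x => q₁ x - -(c * p x) :=
      uniformContinuous_of_bounded_hasDerivAt hq₂ (C := (1 + B) * ((∫ y, |W y|) * B)) fun x => by
        rw [abs_neg, abs_mul]
        exact mul_le_mul (hqB x) (hNB x) (abs_nonneg _) (by positivity)
    have h2 := h1.sub (hpu.const_smul c)
    simpa using! h2
  have ae_deriv : ∀ {f f' w : ℝ → ℝ}, (∀ x, HasDerivAt f (f' x) x) → LocallyIntegrable w →
      (∀ x y, f y - f x = ∫ t in x..y, w t) → w =ᵐ[volume] f' := by
    intro f f' w hf hw hfw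
    filter_upwards [LocallyIntegrable.ae_hasDerivAt_integral hw] with x hx
    have e : f = fun y => f 0 + ∫ t in (0 : ℝ)..y, w t := funext fun y => by linarith [hfw 0 y]
    have h1 := (hx 0).const_add (f 0)
    rw [← e] at h1
    exact h1.unique (hf x)
  have hp₁L : MemLp p₁ 2 volume := hvre.ae_eq (ae_deriv hp₁ hwre hp_int)
  have hq₁L : MemLp q₁ 2 volume := hvim.ae_eq (ae_deriv hq₁ hwim hq_int)
  refine ⟨p₁, q₁, hp₁, hq₁, fun x => ?_, fun x => ?_,
    (tendsto_zero_of_uniformContinuous_of_memLp hp₁u hp₁L).1,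
    (tendsto_zero_of_uniformContinuous_of_memLp hq₁u hq₁L).1, hηb, hηt, hηc, ⟨B, hB⟩, hNc⟩
  · have h1 := (hp₂ x).fun_add ((hq₁ x).const_mul c)
    simp only [sub_add_cancel] at h1
    exact h1.congr_deriv (by simp only [hp]; ring)
  · have h1 := (hq₂ x).fun_sub ((hp₁ x).const_mul c)
    simp only [sub_neg_eq_add, add_sub_cancel_right] at h1
    exact h1.congr_deriv (by simp only [hq]; ring)

/-! ### Lower bounds for convolutions with a kernel positive near the origin. -/

theorem mul_sub_le_of_hasDerivAt {f f' : ℝ → ℝ} (hf : ∀ x, HasDerivAt f (f' x) x) {a b m : ℝ}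
    (hab : a ≤ b) (h : ∀ t ∈ Icc a b, m ≤ f' t) : m * (b - a) ≤ f b - f a := by
  refine (convex_Icc a b).mul_sub_le_image_sub_of_le_deriv
    (fun x _ => (hf x).continuousAt.continuousWithinAt)
    (fun x _ => (hf x).differentiableAt.differentiableWithinAt) (fun x hx => ?_)
    a (left_mem_Icc.2 hab) b (right_mem_Icc.2 hab) hab
  rw [(hf x).deriv]
  exact h x (interior_subset hx)

section Kernel

variable {W v : ℝ → ℝ} {B : ℝ}

theorem setIntegral_le_conv (hW : Integrable W) (hW0 : ∀ᵐ x, 0 ≤ W x) (hv : Continuous v)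
    (hv0 : ∀ x, 0 ≤ v x) (hB : ∀ x, |v x| ≤ B) (S : Set ℝ) (x : ℝ) :
    ∫ y in S, W y * v (x - y) ≤ conv W v x := by
  rw [conv_apply]
  refine setIntegral_le_integral (integrable_conv_integrand hW hv hB x) ?_
  filter_upwards [hW0] with y hy using mul_nonneg hy (hv0 _)

theorem mul_volume_mul_le_conv (hW : Integrable W) (hW0 : ∀ᵐ x, 0 ≤ W x) (hv : Continuous v)
    (hv0 : ∀ x, 0 ≤ v x) (hB : ∀ x, |v x| ≤ B) {τ σ : ℝ}
    (hσ : ∀ᵐ x : ℝ, x ∈ Ioo (-τ) τ → σ ≤ W x) {α β : ℝ} (hαβ : α ≤ β) (hα : -τ ≤ α)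
    (hβ : β ≤ τ) {x m : ℝ} (hm : 0 ≤ m) (hmv : ∀ y ∈ Ioo α β, m ≤ v (x - y)) :
    σ * (β - α) * m ≤ conv W v x := by
  refine le_trans ?_ (setIntegral_le_conv hW hW0 hv hv0 hB (Ioo α β) x)
  have : ∫ _ in Ioo α β, σ * m = σ * (β - α) * m := by
    rw [setIntegral_const, measureReal_def, Real.volume_Ioo,
      ENNReal.toReal_ofReal (by linarith), smul_eq_mul]
    ring
  rw [← this]
  refine setIntegral_mono_on_ae (integrableOn_const measure_Ioo_lt_top.ne)
    (integrable_conv_integrand hW hv hB x).integrableOn measurableSet_Ioo ?_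
  filter_upwards [hσ, hW0] with y hy hy0 hyS
  have h1 := hy ⟨by linarith [hyS.1], by linarith [hyS.2]⟩
  exact mul_le_mul h1 (hmv y hyS) hm hy0

/-- If the convolution with a kernel that is positive near the origin vanishes at `x`, then the
function vanishes near `x`. -/
theorem eq_zero_of_conv_eq_zero (hW : Integrable W) (hW0 : ∀ᵐ x, 0 ≤ W x) (hv : Continuous v)
    (hv0 : ∀ x, 0 ≤ v x) (hB : ∀ x, |v x| ≤ B) {τ σ : ℝ} (hσ0 : 0 < σ)
    (hσ : ∀ᵐ x : ℝ, x ∈ Ioo (-τ) τ → σ ≤ W x) {x z : ℝ} (hx : conv W v x = 0)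
    (hz : |x - z| < τ) : v z = 0 := by
  by_contra hne
  have hpos : 0 < v z := lt_of_le_of_ne (hv0 z) (Ne.symm hne)
  obtain ⟨r, hr, H⟩ := Metric.eventually_nhds_iff.1
    ((hv.tendsto z).eventually (lt_mem_nhds (half_lt_self hpos)))
  rw [abs_lt] at hz
  -- This radius keeps the window around x - z inside (-τ, τ), where W ≥ σ, and keeps its image in
  -- the neighbourhood of z where v > v z / 2.
  set ρ := min r (min (τ - (x - z)) (τ + (x - z))) with hρ
  have hρ0 : 0 < ρ := lt_min hr (lt_min (by linarith) (by linarith))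
  have h1 : ρ ≤ r := min_le_left _ _
  have h2 : ρ ≤ τ - (x - z) := (min_le_right _ _).trans (min_le_left _ _)
  have h3 : ρ ≤ τ + (x - z) := (min_le_right _ _).trans (min_le_right _ _)
  have := mul_volume_mul_le_conv hW hW0 hv hv0 hB hσ (α := x - z - ρ) (β := x - z + ρ) (x := x)
    (m := v z / 2) (by linarith) (by linarith) (by linarith) (by linarith) fun y hy => by
      refine (H ?_).le
      rw [Real.dist_eq, abs_lt]
      constructor <;> linarith [hy.1, hy.2]
  rw [hx] at this
  have h4 : 0 < σ * (x - z + ρ - (x - z - ρ)) * (v z / 2) := by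
    refine mul_pos (mul_pos hσ0 (by linarith)) (by linarith)
  linarith

/-- Harnack type inequality for eventually monotone supersolutions. -/
theorem exists_harnack (hW : Integrable W) (hW0 : ∀ᵐ x, 0 ≤ W x) {v₁ v₂ : ℝ → ℝ}
    (hv₁ : ∀ x, HasDerivAt v (v₁ x) x) (hv₂ : ∀ x, HasDerivAt v₁ (v₂ x) x)
    (hv0 : ∀ x, 0 ≤ v x) (hB : ∀ x, |v x| ≤ B) {τ σ : ℝ} (hτ : 0 < τ) (hσ0 : 0 < σ)
    (hσ : ∀ᵐ x : ℝ, x ∈ Ioo (-τ) τ → σ ≤ W x) {C a : ℝ} (hC : 0 ≤ C)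
    (hmono : ∀ x < a, 0 ≤ v₁ x) (hineq : ∀ x < a, conv W v x ≤ v₂ x + v₁ x + C * v x) :
    ∃ K ≥ (1 : ℝ), ∃ k > (0 : ℝ), ∃ a', ∀ x < a', v (x + k) ≤ K * v x := by
  have hv : Continuous v := continuous_iff_continuousAt.2 fun x => (hv₁ x).continuousAt
  have hle : ∀ x y, x ≤ y → y < a → v x ≤ v y := fun x y hxy hy => by
    have := mul_sub_le_of_hasDerivAt hv₁ hxy (m := 0) fun t ht => hmono t (by linarith [ht.2])
    linarith
  set h := τ / 4 with hh
  have hh0 : 0 < h := by positivity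
  set σ' := σ * (2 * h) with hσ'
  have hσ'0 : 0 < σ' := by positivity
  -- For y in (-4h, -2h) the point x - y lies to the right of x + 2h, where v is at least v (x + 2h)
  -- by monotonicity.
  have step1 : ∀ x < a - 4 * h, σ' * v (x + 2 * h) ≤ v₂ x + v₁ x + C * v x := fun x hx => by
    refine le_trans ?_ (hineq x (by linarith))
    have := mul_volume_mul_le_conv hW hW0 hv hv0 hB hσ (α := -(4 * h)) (β := -(2 * h)) (x := x)
      (m := v (x + 2 * h)) (by linarith) (by linarith) (by linarith) (hv0 _) fun y hy =>
        hle _ _ (by linarith [hy.2]) (by linarith [hy.1])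
    rw [show -(2 * h) - -(4 * h) = 2 * h by ring] at this
    exact this
  -- Integrating over [x - h, x] turns v'' into v' at the cost of reducing the shift from 2h to h;
  -- the terms at x - h have a favourable sign.
  have step2 : ∀ x < a - 4 * h, σ' * h * v (x + h) ≤ v₁ x + (1 + C * h) * v x := fun x hx => by
    have := mul_sub_le_of_hasDerivAt (f := fun t => v₁ t + v t) (fun t => (hv₂ t).add (hv₁ t))
      (show x - h ≤ x by linarith) (m := σ' * v (x + h) - C * v x) fun t ht => by
        have h1 := step1 t (by linarith [ht.2])
        have h2 := hle (x + h) (t + 2 * h) (by linarith [ht.1]) (by linarith [ht.2])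
        have h3 := hle t x ht.2 (by linarith)
        have h4 := mul_le_mul_of_nonneg_left h2 hσ'0.le
        have h5 := mul_le_mul_of_nonneg_left h3 hC
        linarith
    have h6 := hmono (x - h) (by linarith)
    have h7 := hv0 (x - h)
    simp only [sub_sub_cancel] at this
    linarith
  -- A second integration, over [x - h/2, x], turns v' into v and leaves the shift h/2.
  have step3 : ∀ x < a - 4 * h,
      σ' * h * (h / 2) * v (x + h / 2) ≤ (1 + (1 + C * h) * (h / 2)) * v x := fun x hx => by
    have := mul_sub_le_of_hasDerivAt hv₁ (show x - h / 2 ≤ x by linarith)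
      (m := σ' * h * v (x + h / 2) - (1 + C * h) * v x) fun t ht => by
        have h1 := step2 t (by linarith [ht.2])
        have h2 := hle (x + h / 2) (t + h) (by linarith [ht.1]) (by linarith [ht.2])
        have h3 := hle t x ht.2 (by linarith)
        have h4 := mul_le_mul_of_nonneg_left h2 (by positivity : 0 ≤ σ' * h)
        have h5 := mul_le_mul_of_nonneg_left h3 (by positivity : 0 ≤ 1 + C * h)
        linarith
    have h7 := hv0 (x - h / 2)
    simp only [sub_sub_cancel] at this
    linarith
  set q := σ' * h * (h / 2) with hq
  have hq0 : 0 < q := by positivity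
  refine ⟨max 1 ((1 + (1 + C * h) * (h / 2)) / q), le_max_left _ _, h / 2, by positivity,
    a - 4 * h, fun x hx => ?_⟩
  have h1 := step3 x hx
  calc v (x + h / 2) ≤ (1 + (1 + C * h) * (h / 2)) / q * v x := by
        rw [div_mul_eq_mul_div, le_div_iff₀ hq0]; linarith
    _ ≤ _ := mul_le_mul_of_nonneg_right (le_max_right _ _) (hv0 x)

/-- Writing e^{-sx} = e^{-sy} e^{-s(x - y)} and exchanging the integrals makes the left side appear:
for |y| ≤ R the shifted interval (l - y, b - y) contains (l + R, b - R). All discarded contributions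
are nonnegative. -/
theorem integral_mul_integral_le_integral_exp_mul_conv (hW : Integrable W)
    (hW0 : ∀ᵐ x, 0 ≤ W x) (hv : Continuous v)
    (hv0 : ∀ x, 0 ≤ v x) (hB : ∀ x, |v x| ≤ B) {s R l b : ℝ} (hR : 0 ≤ R)
    (hlb : l + R ≤ b - R) :
    (∫ y in (-R)..R, W y * Real.exp (-(s * y))) *
        (∫ x in (l + R)..(b - R), v x * Real.exp (-(s * x)))
      ≤ ∫ x in l..b, Real.exp (-(s * x)) * conv W v x := by
  set g := fun x => v x * Real.exp (-(s * x)) with hg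
  have hgc : Continuous g := by fun_prop
  have hg0 : ∀ x, 0 ≤ g x := fun x => mul_nonneg (hv0 x) (Real.exp_pos _).le
  have hlb' : l ≤ b := by linarith
  have hRR : -R ≤ R := by linarith
  have hWe : IntegrableOn (fun y => W y * Real.exp (-(s * y))) (Ioc (-R) R) := by
    refine IntegrableOn.mono_set ?_ Ioc_subset_Icc_self
    exact hW.integrableOn.mul_continuousOn (by fun_prop) isCompact_Icc
  have hF : Integrable (fun z : ℝ × ℝ => W z.2 * (Real.exp (-(s * z.1)) * v (z.1 - z.2)))
      ((volume.restrict (Ioc l b)).prod (volume.restrict (Ioc (-R) R))) := by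
    refine Integrable.mul_bdd (c := Real.exp (|s| * (|l| + |b|)) * B)
      (Integrable.comp_snd hW.integrableOn _) ?_ ?_
    · exact (by fun_prop : Continuous fun z : ℝ × ℝ =>
        Real.exp (-(s * z.1)) * v (z.1 - z.2)).aestronglyMeasurable
    · rw [Measure.prod_restrict]
      refine (ae_restrict_iff' (measurableSet_Ioc.prod measurableSet_Ioc)).2
        (Eventually.of_forall fun z hz => ?_)
      rw [norm_mul, Real.norm_eq_abs, Real.abs_exp]
      gcongr
      · have h1 : |z.1| ≤ |l| + |b| := by
          rw [abs_le]
          constructor <;>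
          linarith [hz.1.1, hz.1.2, neg_abs_le l, neg_abs_le b, le_abs_self b,
            abs_nonneg l, abs_nonneg b]
        calc -(s * z.1) ≤ |s * z.1| := neg_le_abs _
          _ ≤ _ := by rw [abs_mul]; gcongr
      · exact hB _
  have hswap : ∫ x in Ioc l b, (∫ y in Ioc (-R) R, W y * (Real.exp (-(s * x)) * v (x - y)))
      = ∫ y in Ioc (-R) R, (∫ x in Ioc l b, W y * (Real.exp (-(s * x)) * v (x - y))) :=
    integral_integral_swap hF
  rw [intervalIntegral.integral_of_le hRR, intervalIntegral.integral_of_le hlb',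
    ← integral_mul_const]
  calc ∫ y in Ioc (-R) R, W y * Real.exp (-(s * y)) * (∫ x in (l + R)..(b - R), g x)
      ≤ ∫ y in Ioc (-R) R, (∫ x in Ioc l b, W y * (Real.exp (-(s * x)) * v (x - y))) := by
        refine setIntegral_mono_on_ae (hWe.mul_const _) hF.integral_prod_right measurableSet_Ioc ?_
        filter_upwards [hW0] with y hy0 hy
        have e : ∀ x, W y * (Real.exp (-(s * x)) * v (x - y))
            = W y * Real.exp (-(s * y)) * g (x - y) := fun x => by
          simp only [hg]
          rw [show -(s * x) = -(s * y) + -(s * (x - y)) by ring, Real.exp_add]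
          ring
        simp only [e]
        rw [integral_const_mul, ← intervalIntegral.integral_of_le hlb',
          intervalIntegral.integral_comp_sub_right]
        refine mul_le_mul_of_nonneg_left ?_ (mul_nonneg hy0 (Real.exp_pos _).le)
        exact intervalIntegral.integral_mono_interval (by linarith [hy.1]) hlb (by linarith [hy.2])
          (Eventually.of_forall hg0) (hgc.intervalIntegrable _ _)
    _ = ∫ x in Ioc l b, (∫ y in Ioc (-R) R, W y * (Real.exp (-(s * x)) * v (x - y))) := hswap.symm
    _ ≤ ∫ x in Ioc l b, Real.exp (-(s * x)) * conv W v x := by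
        refine integral_mono hF.integral_prod_left ?_ fun x => ?_
        · have := continuous_conv hW hv hB
          exact ((by fun_prop : Continuous fun x =>
            Real.exp (-(s * x)) * conv W v x).integrableOn_Icc).mono_set Ioc_subset_Icc_self
        · have e : ∀ y, W y * (Real.exp (-(s * x)) * v (x - y))
              = Real.exp (-(s * x)) * (W y * v (x - y)) := fun y => by ring
          simp only [e]
          rw [integral_const_mul]
          exact mul_le_mul_of_nonneg_left (setIntegral_le_conv hW hW0 hv hv0 hB _ x)
            (Real.exp_pos _).le

end Kernel

/-! ### The Laplace condition and exponential decay rates. -/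

/-- A bound by (s² + c²)/2 on all truncations would pass to the limit and make the transform finite;
the hypothesis would then give s² + c² + 2cs < s² + c². The result is a strict inequality for a
compactly supported kernel, also when the full transform is infinite. -/
theorem exists_lt_integral_of_laplace {W : ℝ → ℝ} (hW : Integrable W) (hW0 : ∀ᵐ x, 0 ≤ W x)
    {c s : ℝ} (hc : 0 ≤ c) (hs : 0 ≤ s)
    (h : ((s ^ 2 : ℝ) : EReal) - 2 * laplace W s + ((c ^ 2 : ℝ) : EReal)
        < ((-(2 * c * s) : ℝ) : EReal)) :
    ∃ R > (0 : ℝ), s ^ 2 + c ^ 2 < 2 * ∫ y in (-R)..R, W y * Real.exp (-(s * y)) := by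
  by_contra! hcon
  have hint : ∀ R : ℝ, IntegrableOn (fun y => W y * Real.exp (-(s * y))) (Ioi (-R)) := by
    intro R
    refine Integrable.mul_bdd (c := Real.exp (s * R)) hW.integrableOn
      (by fun_prop : Continuous fun y : ℝ => Real.exp (-(s * y))).aestronglyMeasurable ?_
    refine (ae_restrict_iff' measurableSet_Ioi).2 (Eventually.of_forall fun y hy => ?_)
    rw [Real.norm_eq_abs, Real.abs_exp, Real.exp_le_exp]
    have hy' : -R < y := hy
    nlinarith
  have htr : ∀ R : ℝ, 0 < R → laplaceTrunc W s R ≤ (s ^ 2 + c ^ 2) / 2 := fun R hR => by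
    refine le_of_tendsto (intervalIntegral_tendsto_integral_Ioi (-R) (hint R) tendsto_id) ?_
    filter_upwards [eventually_ge_atTop R] with n hn
    have hn' : R ≤ n := hn
    have h1 : ∫ y in (-R)..n, W y * Real.exp (-(s * y))
        ≤ ∫ y in (-n)..n, W y * Real.exp (-(s * y)) := by
      refine intervalIntegral.integral_mono_interval (by linarith) (by linarith) le_rfl ?_ ?_
      · exact ae_restrict_of_ae (by
          filter_upwards [hW0] with y hy using mul_nonneg hy (Real.exp_pos _).le)
      · rw [intervalIntegrable_iff_integrableOn_Ioc_of_le (by linarith)]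
        exact (hint n).mono_set Ioc_subset_Ioi_self
    have h2 := hcon n (by linarith)
    simp only [id]
    linarith
  have hL : laplace W s ≤ (((s ^ 2 + c ^ 2) / 2 : ℝ) : EReal) := by
    refine le_of_tendsto (tendsto_laplaceTrunc hW hW0 hs) ?_
    filter_upwards [eventually_gt_atTop 0] with R hR
    exact EReal.coe_le_coe_iff.2 (htr R hR)
  have hL0 : (0 : EReal) ≤ laplace W s := by
    refine ge_of_tendsto (tendsto_laplaceTrunc hW hW0 hs) (Eventually.of_forall fun R => ?_)
    rw [← EReal.coe_zero, EReal.coe_le_coe_iff]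
    refine setIntegral_nonneg_of_ae_restrict (ae_restrict_of_ae ?_)
    filter_upwards [hW0] with y hy using mul_nonneg hy (Real.exp_pos _).le
  generalize laplace W s = L at *
  induction L with
  | bot => simp at hL0
  | top => simp at hL
  | coe L =>
    rw [show (2 : EReal) = ((2 : ℝ) : EReal) from rfl, ← EReal.coe_mul, ← EReal.coe_sub,
      ← EReal.coe_add, EReal.coe_lt_coe_iff] at h
    rw [EReal.coe_le_coe_iff] at hL
    nlinarith [mul_nonneg hc hs]

/-- A function satisfying the recursive lower bound `P l ≥ (1 + 2κ) P (l + R) - C` cannot be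
unbounded and grow at an exponential rate lower than the one of the recursion. -/
theorem not_unbounded_of_recursive_growth {P : ℝ → ℝ} {κ R C M r b : ℝ} (hκ : 0 < κ)
    (hR : 0 < R) (hanti : ∀ l ≤ b, P b ≤ P l)
    (hrec : ∀ l ≤ b, (1 + 2 * κ) * P l - C ≤ P (l - R))
    (hM : ∀ l ≤ b, P l ≤ M * Real.exp (-(r * l))) (hr : Real.exp (r * R) < 1 + κ) :
    κ * P b ≤ C ∨ P b ≤ 0 := by
  by_contra! hcon
  obtain ⟨h1, h2⟩ := hcon
  -- Because κ P b > C, the additive loss C is absorbed by half of the gain 2κ, leaving the factor 1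
  -- + κ at each step.
  have hn : ∀ n : ℕ, (1 + κ) ^ n * P b ≤ P (b - n * R) := fun n => by
    induction n with
    | zero => simp
    | succ n ih =>
      have hb : b - n * R ≤ b := by
        have : (0 : ℝ) ≤ n * R := by positivity
        linarith
      have h3 := hrec _ hb
      have h4 := hanti _ hb
      rw [show b - n * R - R = b - ((n + 1 : ℕ) : ℝ) * R by push_cast; ring] at h3
      have h5 : (1 + κ) * ((1 + κ) ^ n * P b) ≤ (1 + κ) * P (b - n * R) := by gcongr
      have h6 : κ * P b ≤ κ * P (b - n * R) := by gcongr
      rw [pow_succ']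
      nlinarith
  have hM0 : ∀ n : ℕ, (1 + κ) ^ n * P b ≤ M * Real.exp (-(r * b)) * Real.exp (r * R) ^ n :=
    fun n => by
      refine (hn n).trans ((hM _ ?_).trans_eq ?_)
      · have : (0 : ℝ) ≤ n * R := by positivity
        linarith
      · rw [← Real.exp_nat_mul, mul_assoc, ← Real.exp_add]
        congr 2
        ring
  have hq : 1 < (1 + κ) / Real.exp (r * R) := (one_lt_div (Real.exp_pos _)).2 hr
  obtain ⟨n, hn'⟩ := pow_unbounded_of_one_lt (M * Real.exp (-(r * b)) / P b) hq
  rw [div_pow, div_lt_div_iff₀ h2 (by positivity)] at hn'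
  linarith [hM0 n]

/-- The set of exponential decay rates at `-∞`. -/
def decayRates (v : ℝ → ℝ) : Set ℝ :=
  {s | 0 ≤ s ∧ ∃ M, ∀ x ≤ 0, v x ≤ M * Real.exp (s * x)}

/-- Iterating the Harnack inequality to the left gives v (x₀ - nk) ≥ K^{-n} v x₀, so v cannot decay
faster than at the rate log K / k. -/
theorem bddAbove_decayRates {v : ℝ → ℝ} (hv0 : ∀ a, ∃ x < a, 0 < v x) {K k a : ℝ} (hK : 1 ≤ K)
    (hk : 0 < k) (hh : ∀ x < a, v (x + k) ≤ K * v x) : BddAbove (decayRates v) := by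
  obtain ⟨x₀, hx₀, hpos⟩ := hv0 (min a 0)
  have hxa : x₀ < a := hx₀.trans_le (min_le_left _ _)
  have hx0 : x₀ < 0 := hx₀.trans_le (min_le_right _ _)
  have hK0 : 0 < K := by linarith
  have hn : ∀ n : ℕ, v x₀ ≤ K ^ n * v (x₀ - n * k) := fun n => by
    induction n with
    | zero => simp
    | succ n ih =>
      have : (0 : ℝ) ≤ n * k := by positivity
      have h1 := hh (x₀ - ((n + 1 : ℕ) : ℝ) * k) (by push_cast; linarith)
      rw [show x₀ - ((n + 1 : ℕ) : ℝ) * k + k = x₀ - n * k by push_cast; ring] at h1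
      calc v x₀ ≤ K ^ n * v (x₀ - n * k) := ih
        _ ≤ K ^ n * (K * v (x₀ - ((n + 1 : ℕ) : ℝ) * k)) := by gcongr
        _ = _ := by ring
  refine ⟨Real.log K / k, fun s hs => ?_⟩
  obtain ⟨hs0, M, hM⟩ := hs
  by_contra! hlt
  rw [div_lt_iff₀ hk, Real.log_lt_iff_lt_exp hK0] at hlt
  have hq : 1 < Real.exp (s * k) / K := (one_lt_div hK0).2 hlt
  obtain ⟨n, hn'⟩ := pow_unbounded_of_one_lt (M * Real.exp (s * x₀) / v x₀) hq
  rw [div_pow, div_lt_div_iff₀ hpos (by positivity)] at hn'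
  have hnk : (0 : ℝ) ≤ n * k := by positivity
  have h1 := hM (x₀ - n * k) (by linarith)
  have h2 : K ^ n * v (x₀ - n * k) ≤ K ^ n * (M * Real.exp (s * (x₀ - n * k))) := by gcongr
  have h3 : Real.exp (s * (x₀ - n * k)) * Real.exp (s * k) ^ n = Real.exp (s * x₀) := by
    rw [← Real.exp_nat_mul, ← Real.exp_add]; congr 1; ring
  have h4 : v x₀ * Real.exp (s * k) ^ n
      ≤ K ^ n * (M * Real.exp (s * (x₀ - n * k))) * Real.exp (s * k) ^ n :=
    mul_le_mul_of_nonneg_right ((hn n).trans h2) (by positivity)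
  have h5 : K ^ n * (M * Real.exp (s * (x₀ - n * k))) * Real.exp (s * k) ^ n
      = M * Real.exp (s * x₀) * K ^ n := by rw [← h3]; ring
  linarith

/-- On [-R, R] one has e^{-δy} ≥ e^{-δR}. This carries the strict Laplace inequality from the
critical rate S to S + δ with a loss that vanishes as δ → 0. -/
theorem exp_mul_integral_le_integral {W : ℝ → ℝ} (hW : Integrable W) (hW0 : ∀ᵐ x, 0 ≤ W x)
    {S δ R : ℝ} (hR : 0 ≤ R) (hδ : 0 ≤ δ) :
    Real.exp (-(δ * R)) * ∫ y in (-R)..R, W y * Real.exp (-(S * y))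
      ≤ ∫ y in (-R)..R, W y * Real.exp (-((S + δ) * y)) := by
  rw [← intervalIntegral.integral_const_mul]
  have hi : ∀ t : ℝ, IntervalIntegrable (fun y => W y * Real.exp (-(t * y))) volume (-R) R :=
    fun t => hW.intervalIntegrable.mul_continuousOn (by fun_prop)
  rw [intervalIntegral.integral_of_le (by linarith), intervalIntegral.integral_of_le (by linarith)]
  refine setIntegral_mono_on_ae ((hi S).const_mul _).1 (hi (S + δ)).1 measurableSet_Ioc ?_
  filter_upwards [hW0] with y hy0 hy
  have : Real.exp (-(δ * R)) * (W y * Real.exp (-(S * y)))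
      = W y * Real.exp (-(δ * R) + -(S * y)) := by rw [Real.exp_add]; ring
  rw [this]
  refine mul_le_mul_of_nonneg_left (Real.exp_le_exp.2 ?_) hy0
  nlinarith [hy.2]

/-- The Laplace transform of the differential inequality on a half line; the boundary term at the
left end point has a sign. -/
theorem mul_integral_exp_mul_conv_le {W v v₁ v₂ : ℝ → ℝ} {c B δ s l b : ℝ} (hW : Integrable W)
    (hv₁ : ∀ x, HasDerivAt v (v₁ x) x)
    (hv₂ : ∀ x, HasDerivAt v₁ (v₂ x) x) (hv₂c : Continuous v₂)
    (hB : ∀ x, |v x| ≤ B) (hδ0 : 0 ≤ δ) (hs0 : 0 ≤ s) (hl : l ≤ b) (hvl : 0 ≤ v l)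
    (hv₁l : 0 ≤ v₁ l)
    (ha : ∀ x ≤ b, (2 - δ) * conv W v x ≤ v₂ x + δ * v₁ x + (c ^ 2 + δ) * v x) :
    (2 - δ) * (∫ x in l..b, Real.exp (-(s * x)) * conv W v x)
      ≤ Real.exp (-(s * b)) * (v₁ b + (s + δ) * v b) + (s ^ 2 + δ * s + c ^ 2 + δ) *
        ∫ x in l..b, v x * Real.exp (-(s * x)) := by
  have hv : Continuous v := continuous_iff_continuousAt.2 fun x => (hv₁ x).continuousAt
  have hv₁c : Continuous v₁ := continuous_iff_continuousAt.2 fun x => (hv₂ x).continuousAt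
  have hNc := continuous_conv hW hv hB
  set g := fun x => v x * Real.exp (-(s * x)) with hg
  have hgc : Continuous g := by fun_prop
  -- D is a primitive of e^{-sx}(v'' + δv' - s(s + δ)v), so it carries out both integrations by
  -- parts at once. The value D l ≥ 0 is dropped at the end.
  set D := fun x => Real.exp (-(s * x)) * (v₁ x + (s + δ) * v x) with hD
  set D' := fun x => Real.exp (-(s * x)) * (v₂ x + δ * v₁ x) - (s ^ 2 + δ * s) * g x with hD'
  have hD'c : Continuous D' := by fun_prop
  have hDd : ∀ x, HasDerivAt D (D' x) x := fun x => by
    have h1 : HasDerivAt (fun x => Real.exp (-(s * x))) (Real.exp (-(s * x)) * -s) x := by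
      simpa using (((hasDerivAt_id x).const_mul s).neg).exp
    refine (h1.mul ((hv₂ x).add ((hv₁ x).const_mul (s + δ)))).congr_deriv ?_
    simp only [hg, hD', Pi.add_apply]
    ring
  have h1 : ∫ x in l..b, D' x = D b - D l :=
    intervalIntegral.integral_eq_sub_of_hasDerivAt (fun x _ => hDd x)
      (hD'c.intervalIntegrable _ _)
  have h2 : 0 ≤ D l := mul_nonneg (Real.exp_pos _).le
    (add_nonneg hv₁l (mul_nonneg (by linarith) hvl))
  have hc1 : Continuous fun x => (2 - δ) * (Real.exp (-(s * x)) * conv W v x) := by fun_prop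
  have hc2 : Continuous fun x => (s ^ 2 + δ * s + c ^ 2 + δ) * g x := by fun_prop
  rw [← intervalIntegral.integral_const_mul, ← intervalIntegral.integral_const_mul]
  calc ∫ x in l..b, (2 - δ) * (Real.exp (-(s * x)) * conv W v x)
      ≤ ∫ x in l..b, (D' x + (s ^ 2 + δ * s + c ^ 2 + δ) * g x) := by
        refine intervalIntegral.integral_mono_on hl (hc1.intervalIntegrable _ _)
          ((hD'c.add hc2).intervalIntegrable _ _) fun x hx => ?_
        have h3 := mul_le_mul_of_nonneg_left (ha x hx.2) (Real.exp_pos (-(s * x))).le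
        simp only [hg, hD']
        linarith
    _ = D b - D l + ∫ x in l..b, (s ^ 2 + δ * s + c ^ 2 + δ) * g x := by
        rw [intervalIntegral.integral_add (hD'c.intervalIntegrable _ _)
          (hc2.intervalIntegrable _ _), h1]
    _ ≤ _ := by linarith

/-- If s is not a decay rate, v(x)e^{-sx} is unbounded on (-∞, 0]. Monotonicity spreads a large
value at x over [x, x + 1], at the cost of a factor e^{-s}. -/
theorem exists_lt_integral_of_not_mem_decayRates {v v₁ : ℝ → ℝ} {B s b t : ℝ}
    (hv₁ : ∀ x, HasDerivAt v (v₁ x) x) (hv0 : ∀ x, 0 ≤ v x) (hB : ∀ x, |v x| ≤ B)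
    (hs0 : 0 ≤ s) (htb : t + 1 ≤ b) (ha : ∀ x ≤ b, 0 ≤ v₁ x) (hs : s ∉ decayRates v) (Q : ℝ) :
    ∃ l ≤ t, Q < ∫ x in l..b, v x * Real.exp (-(s * x)) := by
  have hv : Continuous v := continuous_iff_continuousAt.2 fun x => (hv₁ x).continuousAt
  have hB0 : 0 ≤ B := (abs_nonneg _).trans (hB 0)
  set g := fun x => v x * Real.exp (-(s * x)) with hg
  have hgc : Continuous g := by fun_prop
  have hg0 : ∀ x, 0 ≤ g x := fun x => mul_nonneg (hv0 x) (Real.exp_pos _).le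
  have hgi : ∀ x y, IntervalIntegrable g volume x y := fun x y => hgc.intervalIntegrable x y
  have hunb : ∀ M : ℝ, ∃ x ≤ 0, M * Real.exp (s * x) < v x := by
    by_contra! hcon
    obtain ⟨M, hM⟩ := hcon
    exact hs ⟨hs0, M, hM⟩
  -- The first entry of the maximum forces x < t, since v ≤ B; the second one makes the integral
  -- exceed Q.
  obtain ⟨x, -, hx⟩ := hunb (max (B * Real.exp (-(s * t))) (Real.exp s * Q))
  have hxt : x < t := by
    by_contra! hge
    have h1 := (le_abs_self _).trans (hB x)
    have h2 : B * Real.exp (-(s * t)) * Real.exp (s * x)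
        ≤ max (B * Real.exp (-(s * t))) (Real.exp s * Q) * Real.exp (s * x) :=
      mul_le_mul_of_nonneg_right (le_max_left _ _) (Real.exp_pos _).le
    rw [mul_assoc, ← Real.exp_add] at h2
    have h3 : 1 ≤ Real.exp (-(s * t) + s * x) := Real.one_le_exp (by nlinarith)
    nlinarith
  refine ⟨x, by linarith, ?_⟩
  have h1 : ∫ y in x..(x + 1), v x * Real.exp (-(s * (x + 1))) ≤ ∫ y in x..(x + 1), g y := by
    refine intervalIntegral.integral_mono_on (by linarith) (by simp) (hgi _ _) fun y hy => ?_
    have h2 := mul_sub_le_of_hasDerivAt hv₁ hy.1 (m := 0) fun z hz =>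
      ha z (by linarith [hz.2, hy.2])
    refine mul_le_mul (by linarith) (Real.exp_le_exp.2 ?_) (Real.exp_pos _).le (hv0 y)
    nlinarith [hy.2]
  rw [intervalIntegral.integral_const, add_sub_cancel_left, one_smul] at h1
  have h2 : ∫ y in x..(x + 1), g y ≤ ∫ y in x..b, g y :=
    intervalIntegral.integral_mono_interval le_rfl (by linarith) (by linarith)
      (Eventually.of_forall hg0) (hgi _ _)
  have h3 : Real.exp s * Q * Real.exp (s * x) < v x :=
    lt_of_le_of_lt (mul_le_mul_of_nonneg_right (le_max_right _ _) (Real.exp_pos _).le) hx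
  have h4 : Real.exp s * Q * Real.exp (s * x) * Real.exp (-(s * (x + 1))) = Q := by
    rw [show Real.exp s * Q * Real.exp (s * x) * Real.exp (-(s * (x + 1)))
      = Q * (Real.exp s * Real.exp (s * x) * Real.exp (-(s * (x + 1)))) by ring,
      ← Real.exp_add, ← Real.exp_add, show s + s * x + -(s * (x + 1)) = 0 by ring,
      Real.exp_zero, mul_one]
  have h5 := mul_lt_mul_of_pos_right h3 (Real.exp_pos (-(s * (x + 1))))
  linarith

/-- The integrand is at most M e^{-2δl}, and since b ≤ 0 the length satisfies b - l ≤ e^{-δl}/δ,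
whence the exponent 3δ. -/
theorem integral_le_of_decay {v : ℝ → ℝ} {S δ M b l : ℝ} (hv : Continuous v) (hδ0 : 0 < δ)
    (hM0 : 0 ≤ M) (hb : b ≤ 0) (hM : ∀ x ≤ 0, v x ≤ M * Real.exp ((S - δ) * x)) (hl : l ≤ b) :
    ∫ x in l..b, v x * Real.exp (-((S + δ) * x)) ≤ M / δ * Real.exp (-(3 * δ * l)) := by
  have h1 : ∫ x in l..b, v x * Real.exp (-((S + δ) * x))
      ≤ ∫ x in l..b, M * Real.exp (-(2 * δ * l)) := by
    refine intervalIntegral.integral_mono_on hl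
      ((by fun_prop : Continuous fun x => v x * Real.exp (-((S + δ) * x))).intervalIntegrable _ _)
      (by simp) fun x hx => ?_
    have h2 := mul_le_mul_of_nonneg_right (hM x (by linarith [hx.2]))
      (Real.exp_pos (-((S + δ) * x))).le
    refine h2.trans ?_
    rw [mul_assoc, ← Real.exp_add]
    refine mul_le_mul_of_nonneg_left (Real.exp_le_exp.2 ?_) hM0
    nlinarith [hx.1]
  rw [intervalIntegral.integral_const, smul_eq_mul] at h1
  refine h1.trans ?_
  have h3 : δ * (b - l) ≤ Real.exp (-(δ * l)) := by
    have := Real.add_one_le_exp (-(δ * l))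
    nlinarith
  rw [show -(3 * δ * l) = -(δ * l) + -(2 * δ * l) by ring, Real.exp_add, div_mul_eq_mul_div,
    le_div_iff₀ hδ0]
  have h4 := mul_le_mul_of_nonneg_right h3
    (mul_nonneg hM0 (Real.exp_pos (-(2 * δ * l))).le)
  linarith

/-- A bounded nonnegative function which is nondecreasing near `-∞` cannot be an approximate
supersolution of `v'' + c² v = 2 W * v` near `-∞`, unless it vanishes there. -/
theorem false_of_monotone_supersolution {c : ℝ} (hc : 0 ≤ c) {W : ℝ → ℝ} (hW : Integrable W)
    (hW0 : ∀ᵐ x, 0 ≤ W x) {τ σ : ℝ} (hτ : 0 < τ) (hσ0 : 0 < σ)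
    (hσ : ∀ᵐ x : ℝ, x ∈ Ioo (-τ) τ → σ ≤ W x)
    (hL : ∀ s : ℝ, 0 ≤ s → ((s ^ 2 : ℝ) : EReal) - 2 * laplace W s + ((c ^ 2 : ℝ) : EReal)
        < ((-(2 * c * s) : ℝ) : EReal))
    {v v₁ v₂ : ℝ → ℝ} {B : ℝ} (hv₁ : ∀ x, HasDerivAt v (v₁ x) x)
    (hv₂ : ∀ x, HasDerivAt v₁ (v₂ x) x) (hv₂c : Continuous v₂)
    (hv0 : ∀ x, 0 ≤ v x) (hB : ∀ x, |v x| ≤ B) (hne : ∀ a, ∃ x < a, 0 < v x)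
    (hineq : ∀ ε > 0, ε ≤ 1 → ∃ a, ∀ x < a, 0 ≤ v₁ x ∧
      (2 - ε) * conv W v x ≤ v₂ x + ε * v₁ x + (c ^ 2 + ε) * v x) : False := by
  have hv : Continuous v := continuous_iff_continuousAt.2 fun x => (hv₁ x).continuousAt
  have hB0 : 0 ≤ B := (abs_nonneg _).trans (hB 0)
  have hbdd : BddAbove (decayRates v) := by
    obtain ⟨a, ha⟩ := hineq 1 one_pos le_rfl
    obtain ⟨K, hK, k, hk, a', ha'⟩ := exists_harnack hW hW0 hv₁ hv₂ hv0 hB hτ hσ0 hσ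
      (C := c ^ 2 + 1) (a := a) (by positivity) (fun x hx => (ha x hx).1) fun x hx => by
        linarith [(ha x hx).2]
    exact bddAbove_decayRates hne hK hk ha'
  have hmem0 : (0 : ℝ) ∈ decayRates v :=
    ⟨le_rfl, B, fun x _ => by simpa using (le_abs_self _).trans (hB x)⟩
  set S := sSup (decayRates v) with hS
  have hS0 : 0 ≤ S := le_csSup hbdd hmem0
  obtain ⟨R, hR, hRw⟩ := exists_lt_integral_of_laplace hW hW0 hc hS0 (hL S hS0)
  set w := ∫ y in (-R)..R, W y * Real.exp (-(S * y)) with hw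
  have hw0 : 0 < w := by nlinarith [sq_nonneg S, sq_nonneg c]
  -- the slack of the Laplace condition at the critical decay rate
  obtain ⟨κ, hκ0, hκ⟩ : ∃ κ > (0 : ℝ), (1 + 2 * κ) * (S ^ 2 + c ^ 2) < 2 * w := by
    refine ⟨(2 * w - (S ^ 2 + c ^ 2)) / (4 * (S ^ 2 + c ^ 2 + 1)), ?_, ?_⟩
    · exact div_pos (by linarith) (by positivity)
    · have hp : 0 < S ^ 2 + c ^ 2 + 1 := by positivity
      have : 2 * ((2 * w - (S ^ 2 + c ^ 2)) / (4 * (S ^ 2 + c ^ 2 + 1))) * (S ^ 2 + c ^ 2)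
          < 2 * w - (S ^ 2 + c ^ 2) := by
        rw [show 2 * ((2 * w - (S ^ 2 + c ^ 2)) / (4 * (S ^ 2 + c ^ 2 + 1))) * (S ^ 2 + c ^ 2)
          = (2 * w - (S ^ 2 + c ^ 2)) * (S ^ 2 + c ^ 2) / (2 * (S ^ 2 + c ^ 2 + 1)) by
            field_simp; ring, div_lt_iff₀ (by positivity)]
        nlinarith [sq_nonneg S, sq_nonneg c]
      linarith
  -- Both strict inequalities hold at δ = 0, hence for small δ > 0. The first drives the recursion
  -- for P; the second makes the a priori growth e^{3δR} per step slower than 1 + κ.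
  obtain ⟨δ, hδ1, hδ2, hδ0, hδle⟩ : ∃ δ : ℝ,
      (1 + 2 * κ) * ((S + δ) ^ 2 + δ * (S + δ) + c ^ 2 + δ) < (2 - δ) * (Real.exp (-(δ * R)) * w) ∧
      Real.exp (3 * δ * R) < 1 + κ ∧ 0 < δ ∧ δ ≤ 1 := by
    have e1 : ∀ᶠ δ in 𝓝[>] (0 : ℝ), (1 + 2 * κ) * ((S + δ) ^ 2 + δ * (S + δ) + c ^ 2 + δ)
        < (2 - δ) * (Real.exp (-(δ * R)) * w) := by
      refine Filter.Eventually.filter_mono nhdsWithin_le_nhds ?_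
      refine ContinuousAt.eventually_lt (by fun_prop) (by fun_prop) ?_
      simpa using hκ
    have e2 : ∀ᶠ δ in 𝓝[>] (0 : ℝ), Real.exp (3 * δ * R) < 1 + κ := by
      refine Filter.Eventually.filter_mono nhdsWithin_le_nhds ?_
      refine ContinuousAt.eventually_lt (by fun_prop) (by fun_prop) ?_
      simpa using hκ0
    have e3 : ∀ᶠ δ in 𝓝[>] (0 : ℝ), 0 < δ ∧ δ ≤ 1 := Ioc_mem_nhdsGT one_pos
    obtain ⟨δ, h1, h2, h3⟩ := (e1.and (e2.and e3)).exists
    exact ⟨δ, h1, h2, h3⟩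
  obtain ⟨a, ha⟩ := hineq δ hδ0 hδle
  set s := S + δ with hs
  have hs0 : 0 < s := by linarith
  obtain ⟨M, hM0, hM⟩ : ∃ M > (0 : ℝ), ∀ x ≤ 0, v x ≤ M * Real.exp ((S - δ) * x) := by
    obtain ⟨s', ⟨_, M, hM⟩, hs'⟩ := exists_lt_of_lt_csSup ⟨0, hmem0⟩ (show S - δ < S by linarith)
    refine ⟨max M 1, by positivity, fun x hx => (hM x hx).trans ?_⟩
    have : s' * x ≤ (S - δ) * x := by nlinarith
    exact mul_le_mul (le_max_left _ _) (Real.exp_le_exp.2 this) (Real.exp_pos _).le (by positivity)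
  have hsnot : s ∉ decayRates v := fun h => by
    have := le_csSup hbdd h
    linarith
  set w' := ∫ y in (-R)..R, W y * Real.exp (-(s * y)) with hw'
  have hww' : Real.exp (-(δ * R)) * w ≤ w' :=
    exp_mul_integral_le_integral hW hW0 hR.le hδ0.le
  set g := fun x => v x * Real.exp (-(s * x)) with hg
  have hgc : Continuous g := by fun_prop
  have hg0 : ∀ x, 0 ≤ g x := fun x => mul_nonneg (hv0 x) (Real.exp_pos _).le
  have hgi : ∀ x y, IntervalIntegrable g volume x y := fun x y => hgc.intervalIntegrable x y
  set b := min a 0 - 1 with hb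
  have hba : b < a := by linarith [min_le_left a 0]
  have hb0 : b < 0 := by linarith [min_le_right a 0]
  set P := fun l => ∫ x in l..b, g x with hP
  set A := s ^ 2 + δ * s + c ^ 2 + δ with hA
  have hA0 : 0 < A := by positivity
  have hPanti : ∀ l l', l ≤ l' → l' ≤ b → P l' ≤ P l := fun l l' h1 h2 =>
    intervalIntegral.integral_mono_interval h1 h2 le_rfl (Eventually.of_forall hg0) (hgi _ _)
  set D := fun x => Real.exp (-(s * x)) * (v₁ x + (s + δ) * v x) with hD
  set C₀ := ∫ x in (b - R)..b, g x with hC₀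
  have hC₀0 : 0 ≤ C₀ := intervalIntegral.integral_nonneg (by linarith) fun x _ => hg0 x
  have hDb : 0 ≤ D b := mul_nonneg (Real.exp_pos _).le
      (add_nonneg (ha b hba).1 (mul_nonneg (by linarith) (hv0 b)))
  set C := (1 + 2 * κ) * C₀ + D b / A with hC
  -- Here the integrated inequality on (l - R, b) meets the lower bound for the convolution, whose
  -- inner interval is (l, b - R). The missing piece (b - R, b) is the fixed number `C₀`, and the
  -- boundary term at b is the fixed number `D b`.
  have hrec : ∀ l ≤ b - R, (1 + 2 * κ) * P l - C ≤ P (l - R) := fun l hl => by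
    have h1 := mul_integral_exp_mul_conv_le hW hv₁ hv₂ hv₂c hB hδ0.le hs0.le
      (show l - R ≤ b by linarith) (hv0 _) (ha _ (by linarith)).1
      fun x hx => (ha x (by linarith)).2
    have h2 := integral_mul_integral_le_integral_exp_mul_conv hW hW0 hv hv0 hB (s := s) hR.le
      (l := l - R) (b := b) (by linarith)
    rw [sub_add_cancel] at h2
    have h3 : P l = (∫ x in l..(b - R), g x) + C₀ :=
      (intervalIntegral.integral_add_adjacent_intervals (hgi _ _) (hgi _ _)).symm
    set N := ∫ x in l..(b - R), g x with hN
    have hN0 : 0 ≤ N := intervalIntegral.integral_nonneg (by linarith) fun x _ => hg0 x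
    have h4 : (1 + 2 * κ) * A ≤ (2 - δ) * w' := by
      have := mul_le_mul_of_nonneg_left hww' (by linarith : 0 ≤ 2 - δ)
      linarith
    have h5 := mul_le_mul_of_nonneg_left h2 (by linarith : 0 ≤ 2 - δ)
    have h6 := mul_le_mul_of_nonneg_right h4 hN0
    have h7 : A * ((1 + 2 * κ) * N) ≤ A * (D b / A + P (l - R)) := by
      rw [mul_add, mul_div_cancel₀ _ hA0.ne']
      linarith
    have h8 := le_of_mul_le_mul_left h7 hA0
    rw [h3, hC]
    linarith
  -- The starting point is chosen so far left that P l > C/κ, the threshold beyond which the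
  -- recursion forces growth; l ≤ b - R - 1 keeps the recursion valid.
  obtain ⟨l, hl, hlQ⟩ := exists_lt_integral_of_not_mem_decayRates hv₁ hv0 hB hs0.le
    (show b - R - 1 + 1 ≤ b by linarith) (fun x hx => (ha x (by linarith)).1) hsnot (C / κ)
  have hCκ : 0 ≤ C / κ := by positivity
  have hPl : C / κ < P l := hlQ
  have hCl := (div_lt_iff₀ hκ0).1 hPl
  rcases not_unbounded_of_recursive_growth hκ0 hR (P := P) (b := l) (M := M / δ)
    (r := 3 * δ) (fun l' hl' => hPanti _ _ hl' (by linarith))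
    (fun l' hl' => hrec l' (by linarith)) 
    (fun l' hl' => integral_le_of_decay hv hδ0 hM0.le hb0.le hM (by linarith)) hδ2 with h | h
  · linarith
  · linarith

/-! ### Hydrodynamic formulation of the equation. -/

/-- The hydrodynamic equations for the density of a finite energy solution, where `e = |u'|²`. -/
theorem exists_hydrodynamic {c : ℝ} {W : ℝ → ℝ} (hW : Integrable W) {u : ℝ → ℂ}
    (hu : u ∈ energySpace) (hsol : IsSolution W c u) :
    ∃ η₁ η₂ e : ℝ → ℝ,
      (∀ x, HasDerivAt (density u) (η₁ x) x) ∧ (∀ x, HasDerivAt η₁ (η₂ x) x) ∧ Continuous η₂ ∧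
      (∀ x, η₂ x = 2 * (1 - density u x) * conv W (density u) x - c ^ 2 * density u x - 2 * e x) ∧
      (∀ x, 4 * (1 - density u x) * e x = η₁ x ^ 2 + c ^ 2 * density u x ^ 2) ∧
      Tendsto η₁ atBot (𝓝 0) ∧
      Tendsto (density u) atBot (𝓝 0) ∧ Tendsto (density u) atTop (𝓝 0) ∧
      (∃ B, ∀ x, |density u x| ≤ B) ∧ ((∀ x, e x = 0) → ∃ z, ∀ x, u x = z) := by
  obtain ⟨p₁, q₁, hp₁, hq₁, hp₂, hq₂, hp₁b, hq₁b, hηb, hηt, hηc, hB, hNc⟩ :=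
    exists_classical_solution hW hu hsol
  set η := density u with hη
  set N := conv W η with hN
  set p := fun x => (u x).re with hp
  set q := fun x => (u x).im with hq
  have hpc : Continuous p := continuous_iff_continuousAt.2 fun x => (hp₁ x).continuousAt
  have hqc : Continuous q := continuous_iff_continuousAt.2 fun x => (hq₁ x).continuousAt
  have hp₁c : Continuous p₁ := continuous_iff_continuousAt.2 fun x => (hp₂ x).continuousAt
  have hq₁c : Continuous q₁ := continuous_iff_continuousAt.2 fun x => (hq₂ x).continuousAt
  change ∀ x, HasDerivAt p₁ (c * q₁ x - p x * N x) x at hp₂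
  change ∀ x, HasDerivAt q₁ (-(c * p₁ x) - q x * N x) x at hq₂
  have hηpq : ∀ x, η x = 1 - (p x ^ 2 + q x ^ 2) := fun x => by
    rw [hη, density, ← Complex.normSq_eq_norm_sq, Complex.normSq_apply]; simp only [hp, hq]; ring
  set η₁ := fun x => -(2 * (p x * p₁ x + q x * q₁ x)) with hη₁
  set e := fun x => p₁ x ^ 2 + q₁ x ^ 2 with he
  have hd : ∀ x, HasDerivAt η (η₁ x) x := fun x => by
    rw [show η = fun x => 1 - (p x ^ 2 + q x ^ 2) from funext hηpq]
    refine ((((hp₁ x).pow 2).add ((hq₁ x).pow 2)).const_sub 1).congr_deriv ?_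
    simp only [hη₁]
    ring
  have hJd : ∀ x, HasDerivAt (fun x => p x * q₁ x - q x * p₁ x - c / 2 * η x) 0 x := fun x => by
    refine ((((hp₁ x).mul (hq₂ x)).sub ((hq₁ x).mul (hp₂ x))).sub
      ((hd x).const_mul (c / 2))).congr_deriv ?_
    simp only [hη₁]
    ring
  have heb : Tendsto (fun x => (1 - η x) * e x) atBot (𝓝 0) := by
    have := (hηb.const_sub 1).mul ((hp₁b.pow 2).add (hq₁b.pow 2))
    simpa using this
  -- Im(ū u') - cη/2 is conserved. At -∞ it vanishes, because |Im(ū u')|² ≤ |u|²|u'|² → 0 and η → 0.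
  have hJ : ∀ x, p x * q₁ x - q x * p₁ x = c / 2 * η x := by
    set K := p 0 * q₁ 0 - q 0 * p₁ 0 - c / 2 * η 0 with hK
    have hconst : ∀ x, p x * q₁ x - q x * p₁ x - c / 2 * η x = K := fun x =>
      is_const_of_deriv_eq_zero (fun x => (hJd x).differentiableAt) (fun x => (hJd x).deriv) x 0
    have h1 : Tendsto (fun x => (c / 2 * η x + K) ^ 2) atBot (𝓝 (K ^ 2)) := by
      have := ((hηb.const_mul (c / 2)).add_const K).pow 2
      simpa using this
    have h2 : K ^ 2 ≤ 0 := le_of_tendsto_of_tendsto' h1 heb fun x => by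
      rw [show c / 2 * η x + K = p x * q₁ x - q x * p₁ x by linarith [hconst x], hηpq x]
      simp only [he]
      nlinarith [sq_nonneg (p x * p₁ x + q x * q₁ x)]
    have h3 : K = 0 := by nlinarith [sq_nonneg K]
    intro x
    linarith [hconst x]
  refine ⟨η₁, fun x => 2 * (1 - η x) * N x - c ^ 2 * η x - 2 * e x, e, hd, fun x => ?_,
    by fun_prop, fun x => rfl, fun x => ?_, ?_, hηb, hηt, hB, fun h0 => ?_⟩
  · refine ((((hp₁ x).mul (hp₂ x)).add ((hq₁ x).mul (hq₂ x))).const_mul 2).neg.congr_deriv ?_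
    have h1 := hJ x
    simp only [he]
    linear_combination (-2 * c) * h1 + 2 * N x * hηpq x
  -- This is |u|²|u'|² = (Re ū u')² + (Im ū u')² with Re ū u' = -η'/2 and Im ū u' = cη/2.
  · have h1 := hJ x
    have h2 : (p x * q₁ x - q x * p₁ x) ^ 2 = (c / 2 * η x) ^ 2 := by rw [h1]
    have h3 := hηpq x
    simp only [he, hη₁]
    linear_combination 4 * h2 - 4 * (p₁ x ^ 2 + q₁ x ^ 2) * h3
  · refine Metric.tendsto_nhds.2 fun ε hε => ?_
    filter_upwards [heb.eventually (gt_mem_nhds (show (0 : ℝ) < ε ^ 2 / 4 by positivity))] with x hx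
    rw [dist_zero_right, Real.norm_eq_abs]
    refine abs_lt_of_sq_lt_sq ?_ hε.le
    have h3 := hηpq x
    rw [h3] at hx
    simp only [he] at hx
    simp only [hη₁]
    nlinarith [sq_nonneg (p x * q₁ x - q x * p₁ x)]
  · have hp0 : ∀ x, p₁ x = 0 := fun x => by
      have h1 := h0 x
      simp only [he] at h1
      nlinarith [sq_nonneg (p₁ x), sq_nonneg (q₁ x)]
    have hq0 : ∀ x, q₁ x = 0 := fun x => by
      have h1 := h0 x
      simp only [he] at h1
      nlinarith [sq_nonneg (p₁ x), sq_nonneg (q₁ x)]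
    refine ⟨u 0, fun x => Complex.ext ?_ ?_⟩
    · exact is_const_of_deriv_eq_zero (f := p) (fun x => (hp₁ x).differentiableAt)
        (fun x => by rw [(hp₁ x).deriv, hp0]) x 0
    · exact is_const_of_deriv_eq_zero (f := q) (fun x => (hq₁ x).differentiableAt)
        (fun x => by rw [(hq₁ x).deriv, hq0]) x 0

/-! ### Propagation of zeros and sign changes of the derivative. -/

theorem conv_neg (W f : ℝ → ℝ) (x : ℝ) : conv W (fun y => -f y) x = -conv W f x := by
  simp only [conv_apply, mul_neg, integral_neg]

theorem eq_zero_of_forall_lt_add {f : ℝ → ℝ} {a r : ℝ} (hr : 0 < r) (ha : ∀ x < a, f x = 0)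
    (hstep : ∀ b, (∀ x < b, f x = 0) → ∀ x < b + r, f x = 0) (x : ℝ) : f x = 0 := by
  have hn : ∀ n : ℕ, ∀ x < a + n * r, f x = 0 := fun n => by
    induction n with
    | zero => simpa using ha
    | succ n ih =>
      have := hstep _ ih
      rwa [show a + n * r + r = a + ((n + 1 : ℕ) : ℝ) * r by push_cast; ring] at this
  obtain ⟨n, hn'⟩ := exists_nat_gt ((x - a) / r)
  rw [div_lt_iff₀ hr] at hn'
  exact hn n x (by linarith)

theorem deriv_eq_zero_of_eq_zero_on_Iio {f f' : ℝ → ℝ} (hf : ∀ x, HasDerivAt f (f' x) x) {a : ℝ}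
    (h : ∀ x < a, f x = 0) : ∀ x < a, f' x = 0 := fun x hx => by
  have h1 : f =ᶠ[𝓝 x] fun _ => 0 := by
    filter_upwards [Iio_mem_nhds hx] with y hy using h y hy
  exact ((hf x).congr_of_eventuallyEq h1.symm).unique (hasDerivAt_const x 0)

section Oscillation

variable {f f' : ℝ → ℝ}

theorem exists_deriv_pos_of_lt (hf : ∀ x, HasDerivAt f (f' x) x) {x y : ℝ} (hxy : x < y)
    (h : f x < f y) : ∃ z ∈ Ioo x y, 0 < f' z := by
  obtain ⟨z, hz, h1⟩ := exists_hasDerivAt_eq_slope f f' hxy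
    (fun x _ => (hf x).continuousAt.continuousWithinAt) fun x _ => hf x
  exact ⟨z, hz, h1 ▸ div_pos (by linarith) (by linarith)⟩

theorem exists_deriv_neg_of_lt (hf : ∀ x, HasDerivAt f (f' x) x) {x y : ℝ} (hxy : x < y)
    (h : f y < f x) : ∃ z ∈ Ioo x y, f' z < 0 := by
  obtain ⟨z, hz, h1⟩ := exists_deriv_pos_of_lt (fun x => (hf x).neg) hxy (neg_lt_neg h)
  exact ⟨z, hz, by linarith⟩

/-- Vanishing at both ends and f p > 0 give f' > 0 at some point left of p and f' < 0 at some point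
right of p. A negative value of f elsewhere would supply the opposite pattern and hence three
alternating signs. So without oscillation f ≥ 0, and f' ≥ 0 to the left of the first point, which
`hno` forbids. -/
theorem exists_oscillation_of_pos (hf : ∀ x, HasDerivAt f (f' x) x) (hb : Tendsto f atBot (𝓝 0))
    (ht : Tendsto f atTop (𝓝 0)) {p : ℝ} (hp : 0 < f p)
    (hno : ∀ x₀, ¬ ((∀ x, 0 ≤ f x) ∧ ∀ x < x₀, 0 ≤ f' x)) :
    ∃ x₁ x₂ x₃ : ℝ, x₁ < x₂ ∧ x₂ < x₃ ∧
      ((0 < f' x₁ ∧ f' x₂ < 0 ∧ 0 < f' x₃) ∨ (f' x₁ < 0 ∧ 0 < f' x₂ ∧ f' x₃ < 0)) := by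
  by_contra! hcon
  obtain ⟨y, hy, hyp⟩ := ((hb.eventually (gt_mem_nhds hp)).and (eventually_lt_atBot p)).exists
  obtain ⟨z, hz, hzp⟩ := ((ht.eventually (gt_mem_nhds hp)).and (eventually_gt_atTop p)).exists
  obtain ⟨q₁, hq₁, hq₁'⟩ := exists_deriv_pos_of_lt hf hyp hy
  obtain ⟨q₂, hq₂, hq₂'⟩ := exists_deriv_neg_of_lt hf hzp hz
  refine hno q₁ ⟨fun r => ?_, fun x hx => ?_⟩
  · by_contra! hr
    obtain ⟨y, hy, hyr⟩ := ((hb.eventually (lt_mem_nhds hr)).and (eventually_lt_atBot r)).exists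
    obtain ⟨z, hz, hzr⟩ := ((ht.eventually (lt_mem_nhds hr)).and (eventually_gt_atTop r)).exists
    obtain ⟨s₁, hs₁, hs₁'⟩ := exists_deriv_neg_of_lt hf hyr hy
    obtain ⟨s₂, hs₂, hs₂'⟩ := exists_deriv_pos_of_lt hf hzr hz
    rcases lt_trichotomy r p with h | h | h
    · obtain ⟨t, ht, ht'⟩ := exists_deriv_pos_of_lt hf h (hr.trans hp)
      have := (hcon s₁ t q₂ (hs₁.2.trans ht.1) (ht.2.trans hq₂.1)).2 hs₁' ht'
      linarith
    · subst h; linarith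
    · obtain ⟨t, ht, ht'⟩ := exists_deriv_neg_of_lt hf h (hr.trans hp)
      have := (hcon q₁ t s₂ (hq₁.2.trans ht.1) (ht.2.trans hs₂.1)).1 hq₁' ht'
      linarith
  · by_contra! hneg
    have := (hcon x q₁ q₂ hx (hq₁.2.trans hq₂.1)).2 hneg hq₁'
    linarith

end Oscillation

end NonlocalGP

/-! ### The main theorem. -/

open NonlocalGP in
theorem theorem1p8
    (c : ℝ) (hc_nonneg : 0 ≤ c) (hc_lt : c < √2)
    (W : ℝ → ℝ)
    (hW_int : Integrable W volume)
    (hW_even : ∀ᵐ x : ℝ, W (-x) = W x)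
    (hW_mass : ∫ x, W x = 1)
    (hW_nonneg : ∀ᵐ x : ℝ, 0 ≤ W x)
    (hW_pos : ∃ τ > (0 : ℝ), ∃ σ > (0 : ℝ), ∀ᵐ x : ℝ, x ∈ Ioo (-τ) τ → σ ≤ W x)
    (hW_laplace : ∀ s : ℝ, 0 ≤ s →
      ((s ^ 2 : ℝ) : EReal) - 2 * NonlocalGP.laplace W s + ((c ^ 2 : ℝ) : EReal)
        < ((-(2 * c * s) : ℝ) : EReal))
    (u : ℝ → ℂ)
    (hu_energy : u ∈ NonlocalGP.energySpace)
    (hu_sol : NonlocalGP.IsSolution W c u)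
    (hu_nontrivial : ¬ ∃ z : ℂ, ∀ x, u x = z) :
    Differentiable ℝ (NonlocalGP.density u) ∧
    (∀ x₀ : ℝ,
      ¬ ((∀ x, 0 ≤ NonlocalGP.density u x) ∧
          ∀ x < x₀, 0 ≤ deriv (NonlocalGP.density u) x) ∧
      ¬ ((∀ x, NonlocalGP.density u x ≤ 0) ∧
          ∀ x < x₀, deriv (NonlocalGP.density u) x ≤ 0)) ∧
    ∃ x₁ x₂ x₃ : ℝ, x₁ < x₂ ∧ x₂ < x₃ ∧
      ((0 < deriv (NonlocalGP.density u) x₁ ∧ deriv (NonlocalGP.density u) x₂ < 0 ∧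
          0 < deriv (NonlocalGP.density u) x₃) ∨
        (deriv (NonlocalGP.density u) x₁ < 0 ∧ 0 < deriv (NonlocalGP.density u) x₂ ∧
          deriv (NonlocalGP.density u) x₃ < 0)) := by
  obtain ⟨τ, hτ, σ, hσ0, hσ⟩ := hW_pos
  obtain ⟨η₁, η₂, e, hd, hd₁, hη₂c, hη₂, he, hη₁b, hηb, hηt, ⟨B, hB⟩, hconst⟩ :=
    exists_hydrodynamic hW_int hu_energy hu_sol
  set η := density u with hη
  have hηc : Continuous η := continuous_iff_continuousAt.2 fun x => (hd x).continuousAt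
  have hderiv : ∀ x, deriv η x = η₁ x := fun x => (hd x).deriv
  have hη0 : ¬ ∀ x, η x = 0 := fun h => hu_nontrivial <| hconst fun x => by
    have h1 : η₁ x = 0 :=
      deriv_eq_zero_of_eq_zero_on_Iio hd (a := x + 1) (fun y _ => h y) x (by linarith)
    have h2 := he x
    rw [h x, h1] at h2
    linarith
  -- Where η vanishes on a half line, so do η', η'' and hence |u'|², and the equation for η'' leaves
  -- only 2 W*η = 0.
  have hconv0 : ∀ a, (∀ x < a, η x = 0) → ∀ x < a, conv W η x = 0 := fun a ha x hx => by
    have h1 := deriv_eq_zero_of_eq_zero_on_Iio hd ha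
    have h2 := deriv_eq_zero_of_eq_zero_on_Iio hd₁ h1 x hx
    have h3 := he x
    have h4 := hη₂ x
    rw [ha x hx, h1 x hx] at h3
    rw [ha x hx, h2] at h4
    linarith
  -- Unique continuation, stated for a general v so as to serve both η and -η. If v = 0 to the left
  -- of b, its convolution vanishes at b - τ/4, which forces v = 0 up to b + τ/2; by iteration η
  -- would vanish identically.
  have hne : ∀ v : ℝ → ℝ, Continuous v → (∀ x, 0 ≤ v x) → (∀ x, |v x| ≤ B) →
      (∀ x, v x = 0 ↔ η x = 0) → (∀ x, conv W η x = 0 → conv W v x = 0) →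
      ∀ a, ∃ x < a, 0 < v x := by
    intro v hv hv0 hvB hvη hconv a
    by_contra! hcon
    refine hη0 fun x => (hvη x).1 (eq_zero_of_forall_lt_add (half_pos hτ)
      (fun x hx => le_antisymm (hcon x hx) (hv0 x)) (fun b hb x hx => ?_) x)
    by_cases hxb : x < b
    · exact hb x hxb
    · refine eq_zero_of_conv_eq_zero hW_int hW_nonneg hv hv0 hvB hσ0 hσ (x := b - τ / 4)
        (hconv _ (hconv0 b (fun y hy => (hvη y).1 (hb y hy)) _ (by linarith))) ?_
      rw [abs_lt]
      constructor <;> linarith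
  have hA : ∀ x₀, ¬ ((∀ x, 0 ≤ η x) ∧ ∀ x < x₀, 0 ≤ η₁ x) := by
    rintro x₀ ⟨hpos, hmono⟩
    refine false_of_monotone_supersolution hc_nonneg hW_int hW_nonneg hτ hσ0 hσ hW_laplace hd hd₁
      hη₂c hpos hB (hne η hηc hpos hB (fun _ => Iff.rfl) fun _ => id) fun ε hε hε1 => ?_
    -- The bound η < ε/2 gives 2(1 - η) ≥ 2 - ε and, as ε ≤ 1, 2|u'|² ≤ η'² + c²η². The bounds (c² +
    -- 1)η < ε and η' < ε turn the latter quadratic terms into at most εη' + εη.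
    have hδ : 0 < min (ε / 2) (ε / (c ^ 2 + 1)) := lt_min (by linarith) (by positivity)
    obtain ⟨a, ha⟩ := eventually_atBot.1 ((hηb.eventually (gt_mem_nhds hδ)).and
      (hη₁b.eventually (gt_mem_nhds hε)))
    refine ⟨min a x₀, fun x hx => ?_⟩
    obtain ⟨h1, h2⟩ := ha x (hx.le.trans (min_le_left _ _))
    have h3 : η x < ε / 2 := h1.trans_le (min_le_left _ _)
    have h4 : η x < ε / (c ^ 2 + 1) := h1.trans_le (min_le_right _ _)
    rw [lt_div_iff₀ (by positivity)] at h4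
    have h5 := hmono x (hx.trans_le (min_le_right _ _))
    refine ⟨h5, ?_⟩
    have h0 := hpos x
    have hN : 0 ≤ conv W η x := by
      rw [conv_apply]
      refine integral_nonneg_of_ae ?_
      filter_upwards [hW_nonneg] with y hy using mul_nonneg hy (hpos _)
    have he0 : 2 * e x ≤ ε * η₁ x + ε * η x := by
      have h6 : η₁ x ^ 2 ≤ ε * η₁ x := by nlinarith
      have h7 : c ^ 2 * η x ^ 2 ≤ ε * η x := by nlinarith
      have h8 := he x
      by_contra! h9
      nlinarith [mul_nonneg hε.le h5, mul_nonneg hε.le h0]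
    have h10 := hη₂ x
    nlinarith
  -- For η ≤ 0 no smallness is needed: with v = -η the factor 2(1 - η) is at least 2 and |u'|²
  -- enters v'' with a plus sign, so v'' + c²v ≥ 2 W*v on the whole half line.
  have hA' : ∀ x₀, ¬ ((∀ x, η x ≤ 0) ∧ ∀ x < x₀, η₁ x ≤ 0) := by
    rintro x₀ ⟨hneg, hmono⟩
    have hneg' : ∀ x, 0 ≤ -η x := fun x => by linarith [hneg x]
    have hB' : ∀ x, |-η x| ≤ B := fun x => by rw [abs_neg]; exact hB x
    refine false_of_monotone_supersolution hc_nonneg hW_int hW_nonneg hτ hσ0 hσ hW_laplace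
      (v := fun x => -η x) (v₁ := fun x => -η₁ x) (v₂ := fun x => -η₂ x)
      (fun x => (hd x).neg) (fun x => (hd₁ x).neg) hη₂c.neg hneg' hB'
      (hne (fun x => -η x) hηc.neg hneg' hB' (fun _ => neg_eq_zero) fun x h => by
        rw [conv_neg, h, neg_zero]) fun ε hε hε1 => ⟨x₀, fun x hx => ?_⟩
    have h5 := hmono x hx
    refine ⟨by linarith, ?_⟩
    have h0 := hneg x
    have hN : 0 ≤ conv W (fun y => -η y) x := by
      rw [conv_apply]
      refine integral_nonneg_of_ae ?_
      filter_upwards [hW_nonneg] with y hy using mul_nonneg hy (hneg' _)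
    rw [conv_neg] at hN ⊢
    have he0 : 0 ≤ e x := by
      have h8 := he x
      by_contra! h9
      nlinarith [sq_nonneg (η₁ x), mul_nonneg (sq_nonneg c) (sq_nonneg (η x))]
    have h10 := hη₂ x
    nlinarith
  refine ⟨fun x => (hd x).differentiableAt, fun x₀ => ?_, ?_⟩
  · simp only [hderiv]
    exact ⟨hA x₀, hA' x₀⟩
  · simp only [hderiv]
    obtain ⟨p, hp⟩ := not_forall.1 hη0
    rcases lt_or_gt_of_ne hp with h | h
    · obtain ⟨x₁, x₂, x₃, h12, h23, hosc⟩ := exists_oscillation_of_pos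
        (f := fun x => -η x) (f' := fun x => -η₁ x) (p := p) (fun x => (hd x).neg)
        (by simpa using hηb.neg) (by simpa using hηt.neg) (by linarith) fun x₀ hx₀ =>
          hA' x₀ ⟨fun x => by linarith [hx₀.1 x], fun x hx => by linarith [hx₀.2 x hx]⟩
      refine ⟨x₁, x₂, x₃, h12, h23, hosc.symm.imp ?_ ?_⟩ <;>
      · rintro ⟨h1, h2, h3⟩
        exact ⟨by linarith, by linarith, by linarith⟩
    · exact exists_oscillation_of_pos hd hηb hηt h hA
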